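/- Let $(N,g)$ be an oriented smooth Riemannian 2-manifold with Gauss curvature $\kappa$. Let $\mathbb G$ be the neutral K\"ahler metric on the total space $TN$ which is given as follows: for a positively oriented conformal coordinate $\xi$ on an open subset of $N$, with $g=e^{2u}\,d\xi\, d\bar\xi$, and the corresponding complex coordinates $(\xi,\eta)$ on $TN$, where $(\xi,\eta)$ stands for the tangent vector $\eta\,\partial_\xi+\bar\eta\,\partial_{\bar\xi}$, $$\mathbb G=2e^{2u}\,\mathrm{Im}\left(d\bar\eta\, d\xi-2\eta\,(\partial_\xi u)\, d\xi\, d\bar\xi\right),$$ products of 1-forms being symmetric products, $\alpha\beta=\tfrac12(\alpha\otimes\beta+\beta\otimes\alpha)$. Orient $TN$ so that $(\mathrm{Re}\,\xi,\mathrm{Re}\,\eta,\mathrm{Im}\,\xi,\mathrm{Im}\,\eta)$ are positively oriented coordinates (this is the orientation for which the K\"ahler form $\Omega=2e^{2u}\,\mathrm{Re}(d\eta\wedge d\bar\xi+2\eta\,(\partial_\xi u)\,d\xi\wedge d\bar\xi)$ is self-dual). Then $\mathbb G$ is anti-self-dual: the self-dual part of its Weyl conformal curvature tensor $W$ vanishes,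 $\mathrm{Weyl}^+=0$. Moreover, in every such coordinate system $(\xi,\eta)$, with respect to the coordinate vectors $\partial_\xi,\partial_{\bar\xi},\partial_\eta,\partial_{\bar\eta}$, $$W_{\xi\bar\xi}{}^{\eta\bar\eta}=i\left(\eta\,\partial_\xi\kappa-\bar\eta\,\partial_{\bar\xi}\kappa\right),$$ and all components $W_{AB}{}^{CD}$ with $\{A,B\}\neq\{\xi,\bar\xi\}$ or $\{C,D\}\neq\{\eta,\bar\eta\}$ vanish. (The curvature convention is $R(X,Y)=\nabla_X\nabla_Y-\nabla_Y\nabla_X-\nabla_{[X,Y]}$, $R(\partial_c,\partial_d)\partial_b=R^a{}_{bcd}\,\partial_a$, and $W_{ab}{}^{cd}=W_{abef}\,\mathbb G^{ec}\mathbb G^{fd}$.) -/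

import Mathlib

open scoped Manifold ContDiff ComplexConjugate Matrix
open Bundle

noncomputable section

namespace NeutralTN

/-! ### Curvature of a (pseudo-)Riemannian metric in local coordinates -/

/-- The partial derivative of `f` in the direction of the `c`-th coordinate. -/
def pd {n : ℕ} (c : Fin n) (f : (Fin n → ℝ) → ℝ) (x : Fin n → ℝ) : ℝ :=
  fderiv ℝ f x (Pi.single c 1)

/-- The components of a metric on (an open part of) `ℝⁿ`, as a function of the point. -/
abbrev CoordMetric (n : ℕ) : Type := (Fin n → ℝ) → Matrix (Fin n) (Fin n) ℝ

/-- Christoffel symbols `Γ^a_{bc}`. -/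
def christoffel {n : ℕ} (G : CoordMetric n) (a b c : Fin n) (x : Fin n → ℝ) : ℝ :=
  (1 / 2) * ∑ d, (G x)⁻¹ a d *
    (pd b (fun y => G y d c) x + pd c (fun y => G y d b) x - pd d (fun y => G y b c) x)

/-- The Riemann tensor `R^a_{bcd}`, that is `R(∂_c, ∂_d) ∂_b = R^a_{bcd} ∂_a` with
`R(X, Y) = ∇_X ∇_Y - ∇_Y ∇_X - ∇_[X,Y]`. -/
def riemann {n : ℕ} (G : CoordMetric n) (a b c d : Fin n) (x : Fin n → ℝ) : ℝ :=
  pd c (christoffel G a d b) x - pd d (christoffel G a c b) x +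
    ∑ e, (christoffel G a c e x * christoffel G e d b x -
      christoffel G a d e x * christoffel G e c b x)

/-- `R_{abcd} = g_{ae} R^e_{bcd}`. -/
def riemannLow {n : ℕ} (G : CoordMetric n) (a b c d : Fin n) (x : Fin n → ℝ) : ℝ :=
  ∑ e, G x a e * riemann G e b c d x

/-- The Ricci tensor `R_{bd} = R^a_{bad}`. -/
def ricci {n : ℕ} (G : CoordMetric n) (b d : Fin n) (x : Fin n → ℝ) : ℝ :=
  ∑ a, riemann G a b a d x

/-- The scalar curvature. -/
def scalarCurv {n : ℕ} (G : CoordMetric n) (x : Fin n → ℝ) : ℝ :=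
  ∑ a, ∑ b, (G x)⁻¹ a b * ricci G a b x

/-- The Gauss curvature `R_{0101} / det g` of a metric in two dimensions. -/
def gauss (g : CoordMetric 2) (x : Fin 2 → ℝ) : ℝ :=
  riemannLow g 0 1 0 1 x / (g x).det

/-- The Weyl conformal curvature tensor `W_{abcd}` in dimension four. -/
def weylLow (G : CoordMetric 4) (a b c d : Fin 4) (x : Fin 4 → ℝ) : ℝ :=
  riemannLow G a b c d x
    - (1 / 2) * (G x a c * ricci G b d x - G x a d * ricci G b c x
        - G x b c * ricci G a d x + G x b d * ricci G a c x)
    + (scalarCurv G x / 6) * (G x a c * G x b d - G x a d * G x b c)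

/-- The Weyl tensor with its last two indices raised, `W_{ab}{}^{cd}`. -/
def weyl (G : CoordMetric 4) (a b c d : Fin 4) (x : Fin 4 → ℝ) : ℝ :=
  ∑ e, ∑ f, weylLow G a b e f x * (G x)⁻¹ e c * (G x)⁻¹ f d

/-! ### Two-forms and self-duality

A 2-form at a point is a skew-symmetric matrix `w = (w_{ab})`.  The coordinates
`(x⁰, x¹, x², x³)` are taken to be positively oriented. -/

/-- The Levi-Civita symbol: the sign of `(a, b, c, d)` if this is a permutation of
`(0, 1, 2, 3)`, and zero otherwise. -/
def leviCivita (a b c d : Fin 4) : ℝ :=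
  (Matrix.of fun i k : Fin 4 => if ![a, b, c, d] i = k then (1 : ℝ) else 0).det

/-- The Hodge star on 2-forms,
`(⋆w)_{ab} = ½ √|det g| ε_{cdab} g^{ce} g^{df} w_{ef}`. -/
def hodgeStar (g : Matrix (Fin 4) (Fin 4) ℝ) (w : Matrix (Fin 4) (Fin 4) ℝ) :
    Matrix (Fin 4) (Fin 4) ℝ :=
  Matrix.of fun a b => (1 / 2) * √|g.det| *
    ∑ c, ∑ d, leviCivita c d a b * ∑ e, ∑ f, g⁻¹ c e * g⁻¹ d f * w e f

/-- The self-dual part `½ (w + ⋆w)` of a 2-form. -/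
def selfDualPart (g : Matrix (Fin 4) (Fin 4) ℝ) (w : Matrix (Fin 4) (Fin 4) ℝ) :
    Matrix (Fin 4) (Fin 4) ℝ :=
  (1 / 2 : ℝ) • (w + hodgeStar g w)

/-- The Weyl tensor as an endomorphism of 2-forms, `(Ww)_{ab} = ½ W_{ab}{}^{cd} w_{cd}`. -/
def weylOp (G : CoordMetric 4) (x : Fin 4 → ℝ) (w : Matrix (Fin 4) (Fin 4) ℝ) :
    Matrix (Fin 4) (Fin 4) ℝ :=
  Matrix.of fun a b => (1 / 2) * ∑ c, ∑ d, weyl G a b c d x * w c d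

/-- `Weyl⁺`, the block of the Weyl endomorphism that maps self-dual 2-forms to self-dual
2-forms, extended by zero to the anti-self-dual ones. -/
def weylPlus (G : CoordMetric 4) (x : Fin 4 → ℝ) (w : Matrix (Fin 4) (Fin 4) ℝ) :
    Matrix (Fin 4) (Fin 4) ℝ :=
  selfDualPart (G x) (weylOp G x (selfDualPart (G x) w))

/-- The metric is anti-self-dual at the point `x`: `Weyl⁺ = 0` there. -/
def IsAntiSelfDualAt (G : CoordMetric 4) (x : Fin 4 → ℝ) : Prop :=
  ∀ w : Matrix (Fin 4) (Fin 4) ℝ, wᵀ = -w → weylPlus G x w = 0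

/-! ### Complex coordinates

Real coordinates on `ℂ` are `(Re ξ, Im ξ)`.  On `ℂ × ℂ` the positively oriented real
coordinates are `(Re ξ, Re η, Im ξ, Im η)`; this is the orientation of the double null coframe
`2 Re dξ, 2 e^{2u} Re (dη + 2 η ∂_ξ u dξ), 2 Im dξ, 2 e^{2u} Im (dη + 2 η ∂_ξ u dξ)`, for which
the Kähler form `Ω` and the forms `Re (dξ ∧ dη)`, `Im (dξ ∧ dη)` are self-dual (it is opposite
to the complex orientation). -/

/-- The derivative `∂_ξ = ½ (∂_x - i ∂_y)` of a real function of `ξ = x + i y`. -/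
def dXi (f : ℂ → ℝ) (ξ : ℂ) : ℂ :=
  (1 / 2) * ((fderiv ℝ f ξ 1 : ℂ) - Complex.I * (fderiv ℝ f ξ Complex.I : ℂ))

/-- The derivative `∂_{ξ̄} = ½ (∂_x + i ∂_y)` of a real function of `ξ = x + i y`. -/
def dXiBar (f : ℂ → ℝ) (ξ : ℂ) : ℂ :=
  (1 / 2) * ((fderiv ℝ f ξ 1 : ℂ) + Complex.I * (fderiv ℝ f ξ Complex.I : ℂ))

/-- The point `ξ` of `ℂ` with the given real coordinates. -/
def toC (x : Fin 2 → ℝ) : ℂ := ⟨x 0, x 1⟩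

/-- The real coordinates of `ξ`. -/
def ofC (ξ : ℂ) : Fin 2 → ℝ := ![ξ.re, ξ.im]

/-- The point `(ξ, η)` of `ℂ × ℂ` with the given real coordinates. -/
def toCC (x : Fin 4 → ℝ) : ℂ × ℂ := (⟨x 0, x 2⟩, ⟨x 1, x 3⟩)

/-- The real coordinates `(Re ξ, Re η, Im ξ, Im η)` of `(ξ, η)`. -/
def ofCC (ξ η : ℂ) : Fin 4 → ℝ := ![ξ.re, η.re, ξ.im, η.im]

/-- The four indices belonging to the complex coordinates `ξ, ξ̄, η, η̄`. -/
inductive CIdx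
  | xi
  | xiBar
  | eta
  | etaBar

/-- The complex coordinate vectors `∂_ξ, ∂_{ξ̄}, ∂_η, ∂_{η̄}` in real coordinates. -/
def CIdx.vec : CIdx → Fin 4 → ℂ
  | xi => ![1 / 2, 0, -(Complex.I / 2), 0]
  | xiBar => ![1 / 2, 0, Complex.I / 2, 0]
  | eta => ![0, 1 / 2, 0, -(Complex.I / 2)]
  | etaBar => ![0, 1 / 2, 0, Complex.I / 2]

/-- The complex covectors `dξ, dξ̄, dη, dη̄` in real coordinates. -/
def CIdx.covec : CIdx → Fin 4 → ℂ
  | xi => ![1, 0, Complex.I, 0]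
  | xiBar => ![1, 0, -Complex.I, 0]
  | eta => ![0, 1, 0, Complex.I]
  | etaBar => ![0, 1, 0, -Complex.I]

/-- The component `W_{AB}{}^{CD}` of the (complex multilinearly extended) Weyl tensor
in the complex coordinates `ξ, ξ̄, η, η̄`. -/
def weylComplex (G : CoordMetric 4) (x : Fin 4 → ℝ) (A B C D : CIdx) : ℂ :=
  ∑ a, ∑ b, ∑ c, ∑ d, (weyl G a b c d x : ℂ) * A.vec a * B.vec b * C.covec c * D.covec d

/-! ### Riemannian 2-manifolds and conformal coordinates -/

section Surface

variable {N : Type*} [TopologicalSpace N] [ChartedSpace ℂ N] [IsManifold 𝓘(ℝ, ℂ) ∞ N]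

/-- A smooth Riemannian metric on the 2-manifold `N`. -/
abbrev SurfaceMetric (N : Type*) [TopologicalSpace N] [ChartedSpace ℂ N]
    [IsManifold 𝓘(ℝ, ℂ) ∞ N] : Type _ :=
  ContMDiffRiemannianMetric 𝓘(ℝ, ℂ) ∞ ℂ (fun p : N => TangentSpace 𝓘(ℝ, ℂ) p)

/-- An orientation of the Riemannian 2-manifold `(N, g)`, given by its smooth field of
rotations through the angle `+π/2` in the tangent planes. -/
structure SurfaceOrientation (g : SurfaceMetric N) where
  /-- The rotation of the tangent plane at `p`. -/
  rot (p : N) : TangentSpace 𝓘(ℝ, ℂ) p →L[ℝ] TangentSpace 𝓘(ℝ, ℂ) p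
  rot_rot (p : N) (v : TangentSpace 𝓘(ℝ, ℂ) p) : rot p (rot p v) = -v
  inner_rot (p : N) (v w : TangentSpace 𝓘(ℝ, ℂ) p) :
    g.inner p (rot p v) (rot p w) = g.inner p v w
  contMDiff : ContMDiff 𝓘(ℝ, ℂ) (𝓘(ℝ, ℂ).prod 𝓘(ℝ, ℂ →L[ℝ] ℂ)) ∞
    (fun p : N => TotalSpace.mk' (ℂ →L[ℝ] ℂ)
      (E := fun p : N => TangentSpace 𝓘(ℝ, ℂ) p →L[ℝ] TangentSpace 𝓘(ℝ, ℂ) p) p (rot p))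

/-- The differential `dξ` at `p` of a local complex coordinate `ξ = φ` on `N`. -/
def dCoord (φ : OpenPartialHomeomorph N ℂ) (p : N) :
    TangentSpace 𝓘(ℝ, ℂ) p →L[ℝ] ℂ :=
  mfderiv 𝓘(ℝ, ℂ) 𝓘(ℝ, ℂ) φ p

/-- `ξ = φ` is a positively oriented conformal coordinate on the open set `φ.source`, with
`ds² = e^{2u} dξ dξ̄` for the function `u = u(ξ, ξ̄)`.  (The smoothness of `u` on the range of
the coordinate is a consequence of that of `g`; it is recorded for convenience.) -/
structure IsConformalCoord (g : SurfaceMetric N) (o : SurfaceOrientation g)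
    (φ : OpenPartialHomeomorph N ℂ) (u : ℂ → ℝ) : Prop where
  mem_maximalAtlas : φ ∈ IsManifold.maximalAtlas 𝓘(ℝ, ℂ) ∞ N
  contDiffOn : ContDiffOn ℝ ∞ u φ.target
  metric : ∀ p ∈ φ.source, ∀ v w : TangentSpace 𝓘(ℝ, ℂ) p,
    g.inner p v w = Real.exp (2 * u (φ p)) * (dCoord φ p v * conj (dCoord φ p w)).re
  oriented : ∀ p ∈ φ.source, ∀ v : TangentSpace 𝓘(ℝ, ℂ) p,
    dCoord φ p (o.rot p v) = Complex.I * dCoord φ p v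

/-- The components of `g` in the real coordinates `(Re ξ, Im ξ)`, `ξ = φ`. -/
def surfaceComponents (g : SurfaceMetric N) (φ : OpenPartialHomeomorph N ℂ) : CoordMetric 2 :=
  fun x => Matrix.of fun a b =>
    let D : ℂ →L[ℝ] TangentSpace 𝓘(ℝ, ℂ) (φ.symm (toC x)) :=
      mfderiv 𝓘(ℝ, ℂ) 𝓘(ℝ, ℂ) φ.symm (toC x)
    g.inner (φ.symm (toC x)) (D (toC (Pi.single a 1))) (D (toC (Pi.single b 1)))

/-- The Gauss curvature `κ` of `(N, g)`, as a function of the coordinate `ξ = φ`. -/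
def gaussCurvature (g : SurfaceMetric N) (φ : OpenPartialHomeomorph N ℂ) (ξ : ℂ) : ℝ :=
  gauss (surfaceComponents g φ) (ofC ξ)

/-! ### The neutral metric on the tangent bundle -/

/-- The complex coordinates `(ξ, η)` on `TN` that belong to the coordinate `ξ = φ` on `N`:
`(ξ, η)` stands for the tangent vector `η ∂_ξ + η̄ ∂_{ξ̄}`, so that `η = dξ(v)`. -/
def bundleCoord (φ : OpenPartialHomeomorph N ℂ) (v : TangentBundle 𝓘(ℝ, ℂ) N) : ℂ × ℂ :=
  (φ v.proj, dCoord φ v.proj v.2)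

/-- The inverse of the coordinates `(ξ, η)`, with `(ξ, η)` in real coordinates. -/
def bundlePoint (φ : OpenPartialHomeomorph N ℂ) (x : Fin 4 → ℝ) : TangentBundle 𝓘(ℝ, ℂ) N :=
  ⟨φ.symm (toCC x).1, mfderiv 𝓘(ℝ, ℂ) 𝓘(ℝ, ℂ) φ.symm (toCC x).1 (toCC x).2⟩

/-- The symmetric bilinear form of
`2 e^{2u} Im (dη̄ dξ - 2 η ∂_ξ u dξ dξ̄)` at the point `(ξ, η)`, where the product of
two 1-forms is the symmetric one, `(α β)(X, Y) = ½ (α(X) β(Y) + α(Y) β(X))`; tangent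
vectors are `X = (dξ(X), dη(X))`. -/
def neutralForm (u : ℂ → ℝ) (P X Y : ℂ × ℂ) : ℝ :=
  2 * Real.exp (2 * u P.1) *
    ((1 / 2) * (conj X.2 * Y.1 + conj Y.2 * X.1)
      - 2 * P.2 * dXi u P.1 * ((1 / 2) * (X.1 * conj Y.1 + Y.1 * conj X.1))).im

open Classical in
/-- The neutral metric `𝔾` on `TN`: at a vector `v`, choose positively oriented conformal
coordinates `ξ` around the base point of `v`, and the corresponding coordinates `(ξ, η)`
on `TN`; then `𝔾 = 2 e^{2u} Im (dη̄ dξ - 2 η ∂_ξ u dξ dξ̄)`. -/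
def neutralMetric (g : SurfaceMetric N) (o : SurfaceOrientation g)
    (v : TangentBundle 𝓘(ℝ, ℂ) N) (X Y : TangentSpace 𝓘(ℝ, ℂ).tangent v) : ℝ :=
  if h : ∃ c : OpenPartialHomeomorph N ℂ × (ℂ → ℝ),
      IsConformalCoord g o c.1 c.2 ∧ v.proj ∈ c.1.source then
    let φ := h.choose.1
    let u := h.choose.2
    let D : TangentSpace 𝓘(ℝ, ℂ).tangent v →L[ℝ] ℂ × ℂ :=
      mfderiv 𝓘(ℝ, ℂ).tangent 𝓘(ℝ, ℂ × ℂ) (bundleCoord φ) v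
    neutralForm u (bundleCoord φ v) (D X) (D Y)
  else 0

/-- The components of `𝔾` in the real coordinates `(Re ξ, Re η, Im ξ, Im η)` on `TN` that
belong to the coordinate `ξ = φ` on `N`. -/
def neutralComponents (g : SurfaceMetric N) (o : SurfaceOrientation g)
    (φ : OpenPartialHomeomorph N ℂ) : CoordMetric 4 :=
  fun x => Matrix.of fun a b =>
    let D : (Fin 4 → ℝ) →L[ℝ] TangentSpace 𝓘(ℝ, ℂ).tangent (bundlePoint φ x) :=
      mfderiv 𝓘(ℝ, Fin 4 → ℝ) 𝓘(ℝ, ℂ).tangent (bundlePoint φ) x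
    neutralMetric g o (bundlePoint φ x) (D (Pi.single a 1)) (D (Pi.single b 1))

end Surface

end NeutralTN

end

noncomputable section

namespace NeutralTN

/-! ### Partial derivatives of functions on `ℂ` and their pullbacks -/

/-! In the coordinates `(ξ, η)` the metric `𝔾` is `e^{2u}` times a matrix affine in `h = 2 Im (η ∂_ξ
u)`, and its curvature can be computed outright. The definition of `𝔾` picks an arbitrary conformal
coordinate at each vector, so `neutralComponents_eq` rests on coordinate independence. Two
positively oriented conformal coordinates differ by a holomorphic `f` with `e^{2u'∘f} |f'|² =
e^{2u}`. The `f''` terms coming from `∂_ξ u` (`dXi_transform`) and from `dη` combine into a real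
quantity, which `Im` discards (`neutralForm_transform`).

The Christoffel symbols are affine in `η`, and the curvature `R^a_{bcd}` involves only `l = Δu` and
`k = 2 Im (η ∂_ξ Δu)`. The scalar curvature vanishes, and removing the Ricci part leaves `W_{abcd} =
e^{2u} (k - 2hl) θ_{ab} θ_{cd}` with `θ = d(Re ξ) ∧ d(Im ξ)` (`weylLow_neutralMatrix`). Since `⋆θ =
-θ` (`hodgeStar_horForm`), the Weyl operator takes values in an anti-self-dual line, so `Weyl⁺ = 0`.
Raising the second `θ` gives a multiple of `∂_{Re η} ∧ ∂_{Im η}`, which singles out the one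
surviving complex component. Finally `κ = -e^{-2u} Δu` (`gaussCurvature_eq`), and differentiating it
gives `e^{-2u} (k - 2hl) = -2 Im (η ∂_ξ κ)` (`weyl_coefficient_eq`). -/

/-- The partial derivative `∂f/∂x` of a real function of `x + i y`. -/
def pdRe (f : ℂ → ℝ) (ξ : ℂ) : ℝ := fderiv ℝ f ξ 1

/-- The partial derivative `∂f/∂y` of a real function of `x + i y`. -/
def pdIm (f : ℂ → ℝ) (ξ : ℂ) : ℝ := fderiv ℝ f ξ Complex.I

@[simp] lemma pdRe_zero : pdRe 0 = 0 := by
  ext ξ; simp [pdRe]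

@[simp] lemma pdIm_zero : pdIm 0 = 0 := by
  ext ξ; simp [pdIm]

@[simp] lemma pdRe_neg (f : ℂ → ℝ) : pdRe (-f) = -pdRe f := by
  ext ξ; simp [pdRe, fderiv_neg]

@[simp] lemma pdIm_neg (f : ℂ → ℝ) : pdIm (-f) = -pdIm f := by
  ext ξ; simp [pdIm, fderiv_neg]

section Smooth

variable {T : Set ℂ} {f : ℂ → ℝ} {ξ : ℂ}

lemma contDiffOn_pdRe (hT : IsOpen T) (hf : ContDiffOn ℝ ∞ f T) :
    ContDiffOn ℝ ∞ (pdRe f) T :=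
  (hf.fderiv_of_isOpen hT (by simp)).clm_apply contDiffOn_const

lemma contDiffOn_pdIm (hT : IsOpen T) (hf : ContDiffOn ℝ ∞ f T) :
    ContDiffOn ℝ ∞ (pdIm f) T :=
  (hf.fderiv_of_isOpen hT (by simp)).clm_apply contDiffOn_const

lemma differentiableAt_of_contDiffOn (hT : IsOpen T) (hf : ContDiffOn ℝ ∞ f T) (hξ : ξ ∈ T) :
    DifferentiableAt ℝ f ξ :=
  (hf.contDiffAt (hT.mem_nhds hξ)).differentiableAt (by simp)

/-- Used as a rewrite rule: mixed partials are brought to the form with `pdRe` outermost, so that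
`ring` can identify them. -/
lemma pdIm_pdRe (hT : IsOpen T) (hf : ContDiffOn ℝ ∞ f T) (hξ : ξ ∈ T) :
    pdIm (pdRe f) ξ = pdRe (pdIm f) ξ := by
  have hd : DifferentiableAt ℝ (fderiv ℝ f) ξ :=
    ((hf.fderiv_of_isOpen hT (m := ∞) (by simp)).contDiffAt (hT.mem_nhds hξ)).differentiableAt
      (by simp)
  have hs : IsSymmSndFDerivAt ℝ f ξ :=
    (hf.contDiffAt (hT.mem_nhds hξ)).isSymmSndFDerivAt
      (by rw [minSmoothness_of_isRCLikeNormedField]; exact WithTop.coe_le_coe.2 (le_top : (2 : ℕ∞) ≤ ⊤))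
  have key : ∀ v w : ℂ, fderiv ℝ (fun z => fderiv ℝ f z v) ξ w = fderiv ℝ (fderiv ℝ f) ξ w v := by
    intro v w
    rw [fderiv_clm_apply hd (differentiableAt_const v)]
    simp
  have h := hs.eq (1 : ℂ) Complex.I
  simp only [pdIm, pdRe]
  change fderiv ℝ (fun z => fderiv ℝ f z 1) ξ Complex.I =
    fderiv ℝ (fun z => fderiv ℝ f z Complex.I) ξ 1
  rw [key, key, h]

lemma pdRe_congr {g : ℂ → ℝ} (hT : IsOpen T) (h : Set.EqOn f g T) (hξ : ξ ∈ T) :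
    pdRe f ξ = pdRe g ξ := by
  rw [pdRe, pdRe, (h.eventuallyEq_of_mem (hT.mem_nhds hξ)).fderiv_eq]

lemma pdIm_pdRe_pdRe (hT : IsOpen T) (hf : ContDiffOn ℝ ∞ f T) (hξ : ξ ∈ T) :
    pdIm (pdRe (pdRe f)) ξ = pdRe (pdRe (pdIm f)) ξ := by
  rw [pdIm_pdRe hT (contDiffOn_pdRe hT hf) hξ]
  exact pdRe_congr hT (fun z hz => pdIm_pdRe hT hf hz) hξ

end Smooth

/-- The function `A + Re η · B + Im η · C` of `(ξ, η)`, for functions `A`, `B`, `C` of `ξ`. -/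
def affineFn (A B C : ℂ → ℝ) (x : Fin 4 → ℝ) : ℝ :=
  A (toCC x).1 + x 1 * B (toCC x).1 + x 3 * C (toCC x).1

/-- The projection `(ξ, η) ↦ ξ` in real coordinates. -/
def projXi : (Fin 4 → ℝ) →L[ℝ] ℂ :=
  (ContinuousLinearMap.proj 0 : (Fin 4 → ℝ) →L[ℝ] ℝ).smulRight (1 : ℂ) +
    (ContinuousLinearMap.proj 2 : (Fin 4 → ℝ) →L[ℝ] ℝ).smulRight Complex.I

lemma projXi_apply (x : Fin 4 → ℝ) : projXi x = (toCC x).1 := by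
  apply Complex.ext <;> simp [projXi, toCC]

/-- The projection `(ξ, η) ↦ η` in real coordinates. -/
def projEta : (Fin 4 → ℝ) →L[ℝ] ℂ :=
  (ContinuousLinearMap.proj 1 : (Fin 4 → ℝ) →L[ℝ] ℝ).smulRight (1 : ℂ) +
    (ContinuousLinearMap.proj 3 : (Fin 4 → ℝ) →L[ℝ] ℝ).smulRight Complex.I

lemma projEta_apply (x : Fin 4 → ℝ) : projEta x = (toCC x).2 := by
  apply Complex.ext <;> simp [projEta, toCC]

lemma continuous_toCC_fst : Continuous fun x : Fin 4 → ℝ => (toCC x).1 := by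
  simpa only [← projXi_apply] using projXi.continuous

lemma hasFDerivAt_comp_toCC_fst {f : ℂ → ℝ} {x : Fin 4 → ℝ}
    (hf : DifferentiableAt ℝ f (toCC x).1) :
    HasFDerivAt (fun y => f (toCC y).1) ((fderiv ℝ f (toCC x).1).comp projXi) x := by
  have h : HasFDerivAt (fun y : Fin 4 → ℝ => (toCC y).1) projXi x := by
    simpa only [← projXi_apply] using projXi.hasFDerivAt
  exact hf.hasFDerivAt.comp x h

lemma hasFDerivAt_affineFn {A B C : ℂ → ℝ} {x : Fin 4 → ℝ}
    (hA : DifferentiableAt ℝ A (toCC x).1) (hB : DifferentiableAt ℝ B (toCC x).1)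
    (hC : DifferentiableAt ℝ C (toCC x).1) :
    HasFDerivAt (affineFn A B C)
      ((fderiv ℝ A (toCC x).1).comp projXi +
        (x 1 • (fderiv ℝ B (toCC x).1).comp projXi +
          B (toCC x).1 • (ContinuousLinearMap.proj 1 : (Fin 4 → ℝ) →L[ℝ] ℝ)) +
        (x 3 • (fderiv ℝ C (toCC x).1).comp projXi +
          C (toCC x).1 • (ContinuousLinearMap.proj 3 : (Fin 4 → ℝ) →L[ℝ] ℝ))) x :=
  ((hasFDerivAt_comp_toCC_fst hA).add
    ((hasFDerivAt_apply 1 x).mul (hasFDerivAt_comp_toCC_fst hB))).add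
    ((hasFDerivAt_apply 3 x).mul (hasFDerivAt_comp_toCC_fst hC))

/-- The metric and its Christoffel symbols are built from functions affine in `η`, so this reduces
differentiation on `TN` to differentiation on `ℂ`. -/
lemma pd_affineFn {A B C : ℂ → ℝ} {x : Fin 4 → ℝ}
    (hA : DifferentiableAt ℝ A (toCC x).1) (hB : DifferentiableAt ℝ B (toCC x).1)
    (hC : DifferentiableAt ℝ C (toCC x).1) (c : Fin 4) :
    pd c (affineFn A B C) x =
      ![affineFn (pdRe A) (pdRe B) (pdRe C) x, B (toCC x).1,
        affineFn (pdIm A) (pdIm B) (pdIm C) x, C (toCC x).1] c := by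
  rw [pd, (hasFDerivAt_affineFn hA hB hC).fderiv]
  have h : projXi (Pi.single c 1) = ![1, 0, Complex.I, 0] c := by
    rw [projXi_apply]
    fin_cases c <;> apply Complex.ext <;> simp [toCC]
  fin_cases c <;> simp [affineFn, pdRe, pdIm] <;> simp at h <;> simp [h]

/-- The real coordinates as a continuous linear map. -/
def toCLM : (Fin 2 → ℝ) →L[ℝ] ℂ :=
  (ContinuousLinearMap.proj 0 : (Fin 2 → ℝ) →L[ℝ] ℝ).smulRight (1 : ℂ) +
    (ContinuousLinearMap.proj 1 : (Fin 2 → ℝ) →L[ℝ] ℝ).smulRight Complex.I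

lemma toCLM_apply (x : Fin 2 → ℝ) : toCLM x = toC x := by
  apply Complex.ext <;> simp [toCLM, toC]

lemma continuous_toC : Continuous toC := by
  have h : toC = toCLM := funext fun x => (toCLM_apply x).symm
  rw [h]; exact toCLM.continuous

lemma pd_comp_toC {f : ℂ → ℝ} {x : Fin 2 → ℝ} (hf : DifferentiableAt ℝ f (toC x)) (c : Fin 2) :
    pd c (fun y => f (toC y)) x = ![pdRe f (toC x), pdIm f (toC x)] c := by
  have h : HasFDerivAt toC toCLM x := by
    have h : toC = toCLM := funext fun x => (toCLM_apply x).symm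
    rw [h]; exact toCLM.hasFDerivAt
  have h2 : toCLM (Pi.single c 1) = ![1, Complex.I] c := by
    rw [toCLM_apply]
    fin_cases c <;> apply Complex.ext <;> simp [toC]
  have h3 : HasFDerivAt (fun y => f (toC y)) ((fderiv ℝ f (toC x)).comp toCLM) x :=
    hf.hasFDerivAt.comp x h
  rw [pd, h3.fderiv, ContinuousLinearMap.comp_apply, h2]
  fin_cases c <;> simp [pdRe, pdIm]

/-! ### The curvature depends only on the germ of the metric -/

section Germ

variable {n : ℕ} {x : Fin n → ℝ}

lemma pd_congr {f g : (Fin n → ℝ) → ℝ} (h : f =ᶠ[nhds x] g) (c : Fin n) : pd c f x = pd c g x := by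
  rw [pd, pd, h.fderiv_eq]

lemma christoffel_congr {G H : CoordMetric n} (h : G =ᶠ[nhds x] H) (a b c : Fin n) :
    christoffel G a b c x = christoffel H a b c x := by
  have key : ∀ a b c, pd c (fun y => G y a b) x = pd c (fun y => H y a b) x := fun a b c =>
    pd_congr (h.mono fun y hy => by rw [hy]) c
  simp only [christoffel, key, h.eq_of_nhds]

/-- The Riemann tensor differentiates the Christoffel symbols, so they must agree near the point and
not only at it. -/
lemma christoffel_eventuallyEq {G H : CoordMetric n} (h : G =ᶠ[nhds x] H) (a b c : Fin n) :
    christoffel G a b c =ᶠ[nhds x] christoffel H a b c :=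
  h.eventuallyEq_nhds.mono fun _ hy => christoffel_congr hy a b c

lemma riemann_congr {G H : CoordMetric n} (h : G =ᶠ[nhds x] H) (a b c d : Fin n) :
    riemann G a b c d x = riemann H a b c d x := by
  simp only [riemann, christoffel_congr h, pd_congr (christoffel_eventuallyEq h _ _ _)]

lemma riemannLow_congr {G H : CoordMetric n} (h : G =ᶠ[nhds x] H) (a b c d : Fin n) :
    riemannLow G a b c d x = riemannLow H a b c d x := by
  simp only [riemannLow, riemann_congr h, h.eq_of_nhds]

lemma ricci_congr {G H : CoordMetric n} (h : G =ᶠ[nhds x] H) (b d : Fin n) :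
    ricci G b d x = ricci H b d x := by
  simp only [ricci, riemann_congr h]

lemma scalarCurv_congr {G H : CoordMetric n} (h : G =ᶠ[nhds x] H) :
    scalarCurv G x = scalarCurv H x := by
  simp only [scalarCurv, ricci_congr h, h.eq_of_nhds]

end Germ

lemma gauss_congr {g h : CoordMetric 2} {x : Fin 2 → ℝ} (H : g =ᶠ[nhds x] h) :
    gauss g x = gauss h x := by
  simp only [gauss, riemannLow_congr H, H.eq_of_nhds]

lemma weyl_congr {G H : CoordMetric 4} {x : Fin 4 → ℝ} (h : G =ᶠ[nhds x] H) (a b c d : Fin 4) :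
    weyl G a b c d x = weyl H a b c d x := by
  simp only [weyl, weylLow, riemannLow_congr h, ricci_congr h, scalarCurv_congr h, h.eq_of_nhds]

lemma riemann_swap {n : ℕ} (G : CoordMetric n) (a b c d : Fin n) (x : Fin n → ℝ) :
    riemann G a b c d x = -riemann G a b d c x := by
  simp only [riemann, neg_add, ← Finset.sum_neg_distrib, neg_sub]

/-! ### The Gauss curvature of a conformally flat metric -/

lemma pd_const_mul {n : ℕ} (c : Fin n) (f : (Fin n → ℝ) → ℝ) (r : ℝ) (x : Fin n → ℝ) :
    pd c (fun y => r * f y) x = r * pd c f x := by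
  have h : (fun y => r * f y) = r • f := rfl
  rw [pd, h, fderiv_const_smul_field]
  rfl

/-- The conformally flat metric `e^{2u} (dx² + dy²)`. -/
def conformalMatrix (u : ℂ → ℝ) : CoordMetric 2 :=
  fun x => Real.exp (2 * u (toC x)) • (1 : Matrix (Fin 2) (Fin 2) ℝ)

/-- The Laplacian of `u` on `ℂ`. -/
def lapl (u : ℂ → ℝ) (ξ : ℂ) : ℝ := pdRe (pdRe u) ξ + pdIm (pdIm u) ξ

/-- The Christoffel symbols `Γ^a_{bc}` of `e^{2u} (dx² + dy²)`. -/
def conformalChristoffel (u : ℂ → ℝ) : Fin 2 → Fin 2 → Fin 2 → ℂ → ℝ :=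
  ![![![pdRe u, pdIm u], ![pdIm u, -pdRe u]], ![![-pdIm u, pdRe u], ![pdRe u, pdIm u]]]

lemma pdRe_exp {u : ℂ → ℝ} {ξ : ℂ} (hu : DifferentiableAt ℝ u ξ) :
    pdRe (fun z => Real.exp (2 * u z)) ξ = Real.exp (2 * u ξ) * (2 * pdRe u ξ) := by
  rw [pdRe, ((hu.hasFDerivAt.const_mul 2).exp).fderiv]
  simp [pdRe]

lemma pdIm_exp {u : ℂ → ℝ} {ξ : ℂ} (hu : DifferentiableAt ℝ u ξ) :
    pdIm (fun z => Real.exp (2 * u z)) ξ = Real.exp (2 * u ξ) * (2 * pdIm u ξ) := by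
  rw [pdIm, ((hu.hasFDerivAt.const_mul 2).exp).fderiv]
  simp [pdIm]

section TwoDim

variable {T : Set ℂ} {u : ℂ → ℝ}

lemma conformalMatrix_inv (u : ℂ → ℝ) (x : Fin 2 → ℝ) :
    (conformalMatrix u x)⁻¹ = (Real.exp (2 * u (toC x)))⁻¹ • (1 : Matrix (Fin 2) (Fin 2) ℝ) := by
  apply Matrix.inv_eq_right_inv
  simp [conformalMatrix, smul_smul]

lemma pd_conformalMatrix {x : Fin 2 → ℝ} (hu : DifferentiableAt ℝ u (toC x)) (a b c : Fin 2) :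
    pd c (fun y => conformalMatrix u y a b) x =
      Real.exp (2 * u (toC x)) * ((1 : Matrix (Fin 2) (Fin 2) ℝ) a b *
        (2 * ![pdRe u (toC x), pdIm u (toC x)] c)) := by
  have h : (fun y => conformalMatrix u y a b) = fun y =>
      (1 : Matrix (Fin 2) (Fin 2) ℝ) a b * (fun z => Real.exp (2 * u z)) (toC y) := by
    ext y; simp [conformalMatrix, mul_comm]
  have hd : DifferentiableAt ℝ (fun z => Real.exp (2 * u z)) (toC x) := (hu.const_mul 2).exp
  rw [h, pd_const_mul, pd_comp_toC hd, pdRe_exp hu, pdIm_exp hu]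
  fin_cases c <;> simp <;> ring

lemma christoffel_conformalMatrix {x : Fin 2 → ℝ} (hu : DifferentiableAt ℝ u (toC x))
    (a b c : Fin 2) :
    christoffel (conformalMatrix u) a b c x = conformalChristoffel u a b c (toC x) := by
  simp only [christoffel, conformalMatrix_inv, pd_conformalMatrix hu, Fin.sum_univ_two]
  fin_cases a <;> fin_cases b <;> fin_cases c <;>
    simp [conformalChristoffel, Matrix.one_apply]

lemma differentiableAt_conformalChristoffel (hT : IsOpen T) (hu : ContDiffOn ℝ ∞ u T)
    {ξ : ℂ} (hξ : ξ ∈ T) (a b c : Fin 2) :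
    DifferentiableAt ℝ (conformalChristoffel u a b c) ξ := by
  have h1 := differentiableAt_of_contDiffOn hT (contDiffOn_pdRe hT hu) hξ
  have h2 := differentiableAt_of_contDiffOn hT (contDiffOn_pdIm hT hu) hξ
  fin_cases a <;> fin_cases b <;> fin_cases c <;>
    simp [conformalChristoffel, h1, h2, h1.neg, h2.neg]

lemma pd_christoffel_conformalMatrix (hT : IsOpen T) (hu : ContDiffOn ℝ ∞ u T)
    {x : Fin 2 → ℝ} (hx : toC x ∈ T) (a b c d : Fin 2) :
    pd d (christoffel (conformalMatrix u) a b c) x =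
      ![pdRe (conformalChristoffel u a b c) (toC x),
        pdIm (conformalChristoffel u a b c) (toC x)] d := by
  have hmem : ∀ᶠ y in nhds x, toC y ∈ T :=
    continuous_toC.continuousAt.eventually (hT.mem_nhds hx)
  have h : christoffel (conformalMatrix u) a b c =ᶠ[nhds x]
      fun y => conformalChristoffel u a b c (toC y) :=
    hmem.mono fun y hy =>
      christoffel_conformalMatrix (differentiableAt_of_contDiffOn hT hu hy) a b c
  rw [pd_congr h, pd_comp_toC (differentiableAt_conformalChristoffel hT hu hx a b c)]

/-- The terms quadratic in `du` cancel, so `R_{0101} = -e^{2u} Δu`, while the determinant is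
`e^{4u}`. -/
lemma gauss_conformalMatrix (hT : IsOpen T) (hu : ContDiffOn ℝ ∞ u T)
    {x : Fin 2 → ℝ} (hx : toC x ∈ T) :
    gauss (conformalMatrix u) x = -(Real.exp (2 * u (toC x)))⁻¹ * lapl u (toC x) := by
  have hF := (Real.exp_pos (2 * u (toC x))).ne'
  have hd := differentiableAt_of_contDiffOn hT hu hx
  simp only [gauss, riemannLow, riemann, pd_christoffel_conformalMatrix hT hu hx,
    christoffel_conformalMatrix hd, Fin.sum_univ_two]
  simp [conformalChristoffel, conformalMatrix, lapl]
  field_simp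
  ring

end TwoDim

/-- A case split that leaves literal indices, which `Matrix.cons_val` evaluates. -/
lemma forall_fin_four {p : Fin 4 → Prop} (h0 : p 0) (h1 : p 1) (h2 : p 2) (h3 : p 3) :
    ∀ i, p i := by
  intro i
  fin_cases i <;> assumption

/-! ### The neutral metric in coordinates and its Christoffel symbols -/

/-- The components of `e^{-2u} 𝔾` at a point with `h = 2 Im (η ∂_ξ u)`. -/
def neutralShape (h : ℝ) : Matrix (Fin 4) (Fin 4) ℝ :=
  !![-2 * h, 0, 0, -1; 0, 0, 1, 0; 0, 1, -2 * h, 0; -1, 0, 0, 0]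

/-- The inverse of `neutralShape h`. -/
def neutralShapeInv (h : ℝ) : Matrix (Fin 4) (Fin 4) ℝ :=
  !![0, 0, 0, -1; 0, 2 * h, 1, 0; 0, 1, 0, 0; -1, 0, 0, 2 * h]

/-- The function `2 Im (η ∂_ξ u)`. -/
def twist (u : ℂ → ℝ) : (Fin 4 → ℝ) → ℝ := affineFn 0 (-pdIm u) (pdRe u)

/-- The metric `2 e^{2u} Im (dη̄ dξ - 2 η ∂_ξ u dξ dξ̄)` in the real coordinates
`(Re ξ, Re η, Im ξ, Im η)`. -/
def neutralMatrix (u : ℂ → ℝ) : CoordMetric 4 :=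
  fun x => Real.exp (2 * u (toCC x).1) • neutralShape (twist u x)

lemma neutralMatrix_inv (u : ℂ → ℝ) (x : Fin 4 → ℝ) :
    (neutralMatrix u x)⁻¹ =
      (Real.exp (2 * u (toCC x).1))⁻¹ • neutralShapeInv (twist u x) := by
  apply Matrix.inv_eq_right_inv
  have h : neutralShape (twist u x) * neutralShapeInv (twist u x) = 1 := by
    ext i j
    fin_cases i <;> fin_cases j <;>
      simp [neutralShape, neutralShapeInv, Matrix.mul_apply, Fin.sum_univ_four]
  simp [neutralMatrix, smul_smul, h]

lemma neutralMatrix_det (u : ℂ → ℝ) (x : Fin 4 → ℝ) :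
    (neutralMatrix u x).det = Real.exp (2 * u (toCC x).1) ^ 4 := by
  have h : (neutralShape (twist u x)).det = 1 := by
    simp [neutralShape, Matrix.det_succ_row_zero, Fin.sum_univ_succ, Fin.succAbove]
    norm_num
  simp [neutralMatrix, h]

/-- The part of the Christoffel symbols of `𝔾` that is constant in `η`. -/
def neutralGamma (u : ℂ → ℝ) : Fin 4 → Fin 4 → Fin 4 → ℂ → ℝ :=
  ![![![pdRe u, 0, pdIm u, 0], 0, ![pdIm u, 0, -pdRe u, 0], 0],
    ![![0, pdRe u, 0, pdIm u], ![pdRe u, 0, pdIm u, 0],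
      ![0, pdIm u, 0, -pdRe u], ![pdIm u, 0, -pdRe u, 0]],
    ![![-pdIm u, 0, pdRe u, 0], 0, ![pdRe u, 0, pdIm u, 0], 0],
    ![![0, -pdIm u, 0, pdRe u], ![-pdIm u, 0, pdRe u, 0],
      ![0, pdRe u, 0, pdIm u], ![pdRe u, 0, pdIm u, 0]]]

/-- The coefficient of `Re η` in the Christoffel symbols of `𝔾`. -/
def neutralGammaRe (u : ℂ → ℝ) : Fin 4 → Fin 4 → Fin 4 → ℂ → ℝ :=
  ![0,
    ![![-pdIm (pdIm u), 0, pdRe (pdIm u), 0], 0, ![pdRe (pdIm u), 0, pdIm (pdIm u), 0], 0],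
    0,
    ![![-pdRe (pdIm u), 0, -pdIm (pdIm u), 0], 0, ![-pdIm (pdIm u), 0, pdRe (pdIm u), 0], 0]]

/-- The coefficient of `Im η` in the Christoffel symbols of `𝔾`. -/
def neutralGammaIm (u : ℂ → ℝ) : Fin 4 → Fin 4 → Fin 4 → ℂ → ℝ :=
  ![0,
    ![![pdRe (pdIm u), 0, -pdRe (pdRe u), 0], 0, ![-pdRe (pdRe u), 0, -pdRe (pdIm u), 0], 0],
    0,
    ![![pdRe (pdRe u), 0, pdRe (pdIm u), 0], 0, ![pdRe (pdIm u), 0, -pdRe (pdRe u), 0], 0]]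

section FourDim

variable {T : Set ℂ} {u : ℂ → ℝ} {x : Fin 4 → ℝ}

/-- The derivative of `neutralShape h` with respect to `h`. -/
def neutralShapeDeriv : Matrix (Fin 4) (Fin 4) ℝ :=
  Matrix.diagonal ![-2, 0, -2, 0]

lemma neutralShape_eq (h : ℝ) (a b : Fin 4) :
    neutralShape h a b = neutralShape 0 a b + neutralShapeDeriv a b * h := by
  fin_cases a <;> fin_cases b <;> simp [neutralShape, neutralShapeDeriv]

lemma pd_mul {n : ℕ} {f g : (Fin n → ℝ) → ℝ} {x : Fin n → ℝ} (hf : DifferentiableAt ℝ f x)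
    (hg : DifferentiableAt ℝ g x) (c : Fin n) :
    pd c (fun y => f y * g y) x = f x * pd c g x + pd c f x * g x := by
  rw [pd, fderiv_fun_mul hf hg]
  simp [pd, mul_comm]

lemma pd_const_add {n : ℕ} (c : Fin n) (f : (Fin n → ℝ) → ℝ) (r : ℝ) (x : Fin n → ℝ) :
    pd c (fun y => r + f y) x = pd c f x := by
  rw [pd, fderiv_const_add, pd]

lemma pd_neutralMatrix (hT : IsOpen T) (hu : ContDiffOn ℝ ∞ u T)
    (hx : (toCC x).1 ∈ T) (a b c : Fin 4) :
    pd c (fun y => neutralMatrix u y a b) x =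
      Real.exp (2 * u (toCC x).1) *
        (2 * ![pdRe u (toCC x).1, 0, pdIm u (toCC x).1, 0] c * neutralShape (twist u x) a b +
          neutralShapeDeriv a b *
            ![affineFn 0 (-pdRe (pdIm u)) (pdRe (pdRe u)) x, -pdIm u (toCC x).1,
              affineFn 0 (-pdIm (pdIm u)) (pdRe (pdIm u)) x, pdRe u (toCC x).1] c) := by
  have hd := differentiableAt_of_contDiffOn hT hu hx
  have h1 := differentiableAt_of_contDiffOn hT (contDiffOn_pdRe hT hu) hx
  have h2 := differentiableAt_of_contDiffOn hT (contDiffOn_pdIm hT hu) hx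
  have h0 : DifferentiableAt ℝ (0 : ℂ → ℝ) (toCC x).1 := differentiableAt_const 0
  have he : DifferentiableAt ℝ (fun z => Real.exp (2 * u z)) (toCC x).1 := (hd.const_mul 2).exp
  have htw : DifferentiableAt ℝ (twist u) x := (hasFDerivAt_affineFn h0 h2.neg h1).differentiableAt
  -- The conformal factor is regarded as affine in `η` with zero slopes, so that `pd_affineFn`
  -- differentiates both factors.
  have e3 : (fun y => neutralMatrix u y a b) = fun y =>
      affineFn (fun z => Real.exp (2 * u z)) 0 0 y *
        (neutralShape 0 a b + neutralShapeDeriv a b * twist u y) := by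
    ext y
    simp [affineFn, neutralMatrix, neutralShape_eq (twist u y)]
  rw [e3, pd_mul (hasFDerivAt_affineFn he h0 h0).differentiableAt
    ((htw.const_mul _).const_add _), pd_const_add, pd_const_mul, pd_affineFn he h0 h0, twist,
    pd_affineFn h0 h2.neg h1, ← twist, neutralShape_eq (twist u x)]
  fin_cases c <;> simp [affineFn, pdRe_exp hd, pdIm_exp hd, pdIm_pdRe hT hu hx] <;> ring

/-- No term quadratic in `η` arises: the entries `2h` of the inverse multiply only `Γ_{1bc}` and
`Γ_{3bc}`, which are free of `η`. The resulting products `h du` cancel against those from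
differentiating `e^{2u}`, so the slopes in `η` are pure second derivatives of `u`. -/
lemma christoffel_neutralMatrix (hT : IsOpen T) (hu : ContDiffOn ℝ ∞ u T)
    (hx : (toCC x).1 ∈ T) (a b c : Fin 4) :
    christoffel (neutralMatrix u) a b c x =
      affineFn (neutralGamma u a b c) (neutralGammaRe u a b c) (neutralGammaIm u a b c) x := by
  have hG : ∀ d, (neutralMatrix u x)⁻¹ a d =
      (Real.exp (2 * u (toCC x).1))⁻¹ * neutralShapeInv (twist u x) a d := fun d => by
    rw [neutralMatrix_inv]; rfl
  simp only [christoffel, hG, pd_neutralMatrix hT hu hx, ← mul_add, ← mul_sub]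
  -- The conformal factor is pulled to the front, where it meets its inverse.
  simp only [mul_assoc, mul_left_comm _ (Real.exp (2 * u (toCC x).1)), Fin.sum_univ_four]
  fin_cases a <;> fin_cases b <;> fin_cases c <;>
    simp [↓Matrix.cons_val, neutralGamma, neutralGammaRe, neutralGammaIm, neutralShape, neutralShapeInv,
      neutralShapeDeriv, twist, affineFn] <;> ring

end FourDim

/-! ### The curvature of the neutral metric -/

/-- The function `2 Im (η ∂_ξ (Δu))`, where `Δ = ∂_x² + ∂_y²`. -/
def laplTwist (u : ℂ → ℝ) (x : Fin 4 → ℝ) : ℝ :=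
  x 3 * pdRe (lapl u) (toCC x).1 - x 1 * pdIm (lapl u) (toCC x).1

/-- The components `R^a_{b 0 1} = R^a_{b 2 3}` of the curvature of `𝔾`. -/
def mixedCurvature (l : ℝ) : Fin 4 → Fin 4 → ℝ :=
  ![0, ![l, 0, 0, 0], 0, ![0, 0, l, 0]]

/-- The components `R^a_{b 0 2}` of the curvature of `𝔾`. -/
def horCurvature (l k : ℝ) : Fin 4 → Fin 4 → ℝ :=
  ![![0, 0, -l, 0], ![-k, 0, 0, -l], ![l, 0, 0, 0], ![0, l, -k, 0]]

/-- The components `R^a_{b c d}` of the curvature of `𝔾`, with indices in the order `c d a b`. -/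
def neutralCurvature (l k : ℝ) : Fin 4 → Fin 4 → Fin 4 → Fin 4 → ℝ :=
  ![![0, mixedCurvature l, horCurvature l k, 0], ![-mixedCurvature l, 0, 0, 0],
    ![-horCurvature l k, 0, 0, mixedCurvature l], ![0, 0, -mixedCurvature l, 0]]

lemma neutralCurvature_swap (l k : ℝ) (a b c d : Fin 4) :
    neutralCurvature l k c d a b = -neutralCurvature l k d c a b := by
  fin_cases c <;> fin_cases d <;> simp [neutralCurvature]

/-- The antisymmetric symbol of the index pair `(0, 2)`, i.e. the 2-form `dx⁰ ∧ dx²`. -/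
def horForm : Matrix (Fin 4) (Fin 4) ℝ :=
  !![0, 0, 1, 0; 0, 0, 0, 0; -1, 0, 0, 0; 0, 0, 0, 0]

/-- The antisymmetric symbol of the index pair `(1, 3)`. -/
def vertForm : Matrix (Fin 4) (Fin 4) ℝ :=
  !![0, 0, 0, 0; 0, 0, 0, 1; 0, 0, 0, 0; 0, -1, 0, 0]

section FourDim

variable {T : Set ℂ} {u : ℂ → ℝ} {x : Fin 4 → ℝ}

lemma pd_christoffel_neutralMatrix (hT : IsOpen T) (hu : ContDiffOn ℝ ∞ u T)
    (hx : (toCC x).1 ∈ T) (a b c d : Fin 4) :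
    pd d (christoffel (neutralMatrix u) a b c) x =
      ![affineFn (pdRe (neutralGamma u a b c)) (pdRe (neutralGammaRe u a b c))
          (pdRe (neutralGammaIm u a b c)) x,
        neutralGammaRe u a b c (toCC x).1,
        affineFn (pdIm (neutralGamma u a b c)) (pdIm (neutralGammaRe u a b c))
          (pdIm (neutralGammaIm u a b c)) x,
        neutralGammaIm u a b c (toCC x).1] d := by
  have hmem : ∀ᶠ y in nhds x, (toCC y).1 ∈ T :=
    continuous_toCC_fst.continuousAt.eventually (hT.mem_nhds hx)
  have h : christoffel (neutralMatrix u) a b c =ᶠ[nhds x]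
      affineFn (neutralGamma u a b c) (neutralGammaRe u a b c) (neutralGammaIm u a b c) :=
    hmem.mono fun y hy => christoffel_neutralMatrix hT hu hy a b c
  have s1 := contDiffOn_pdRe hT hu
  have s2 := contDiffOn_pdIm hT hu
  have h1 := differentiableAt_of_contDiffOn hT s1 hx
  have h2 := differentiableAt_of_contDiffOn hT s2 hx
  have h11 := differentiableAt_of_contDiffOn hT (contDiffOn_pdRe hT s1) hx
  have h12 := differentiableAt_of_contDiffOn hT (contDiffOn_pdRe hT s2) hx
  have h22 := differentiableAt_of_contDiffOn hT (contDiffOn_pdIm hT s2) hx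
  have h0 : DifferentiableAt ℝ (0 : ℂ → ℝ) (toCC x).1 := differentiableAt_const 0
  rw [pd_congr h]
  apply pd_affineFn <;> fin_cases a <;> fin_cases b <;> fin_cases c <;>
    simp [↓Matrix.cons_val, neutralGamma, neutralGammaRe, neutralGammaIm, h0, h1, h2, h11, h12, h22,
      h1.neg, h2.neg, h11.neg, h12.neg, h22.neg]

lemma pdRe_lapl (hT : IsOpen T) (hu : ContDiffOn ℝ ∞ u T) {ξ : ℂ} (hξ : ξ ∈ T) :
    pdRe (lapl u) ξ = pdRe (pdRe (pdRe u)) ξ + pdRe (pdIm (pdIm u)) ξ := by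
  have h : lapl u = pdRe (pdRe u) + pdIm (pdIm u) := rfl
  have h1 := differentiableAt_of_contDiffOn hT (contDiffOn_pdRe hT (contDiffOn_pdRe hT hu)) hξ
  have h2 := differentiableAt_of_contDiffOn hT (contDiffOn_pdIm hT (contDiffOn_pdIm hT hu)) hξ
  rw [pdRe, h, fderiv_add h1 h2]
  rfl

lemma pdIm_lapl (hT : IsOpen T) (hu : ContDiffOn ℝ ∞ u T) {ξ : ℂ} (hξ : ξ ∈ T) :
    pdIm (lapl u) ξ = pdRe (pdRe (pdIm u)) ξ + pdIm (pdIm (pdIm u)) ξ := by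
  have h : lapl u = pdRe (pdRe u) + pdIm (pdIm u) := rfl
  have h1 := differentiableAt_of_contDiffOn hT (contDiffOn_pdRe hT (contDiffOn_pdRe hT hu)) hξ
  have h2 := differentiableAt_of_contDiffOn hT (contDiffOn_pdIm hT (contDiffOn_pdIm hT hu)) hξ
  rw [← pdIm_pdRe_pdRe hT hu hξ, pdIm, h, fderiv_add h1 h2]
  rfl

/-- Skew-symmetry in `c, d` leaves six pairs to compute. Products of derivatives of `u` cancel, and
the second and third derivatives survive only through `Δu` and its gradient. -/
lemma riemann_neutralMatrix_of_lt (hT : IsOpen T) (hu : ContDiffOn ℝ ∞ u T)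
    (hx : (toCC x).1 ∈ T) : ∀ c d : Fin 4, c < d → ∀ a b,
    riemann (neutralMatrix u) a b c d x =
      neutralCurvature (lapl u (toCC x).1) (laplTwist u x) c d a b := by
  have e1 := pdIm_pdRe hT hu hx
  have e2 := pdIm_pdRe hT (contDiffOn_pdIm hT hu) hx
  have e3 := pdIm_pdRe_pdRe hT hu hx
  simp only [riemann, pd_christoffel_neutralMatrix hT hu hx, christoffel_neutralMatrix hT hu hx,
    Fin.sum_univ_four, laplTwist, pdRe_lapl hT hu hx, pdIm_lapl hT hu hx, lapl]
  refine forall_fin_four ?_ ?_ ?_ ?_ <;> refine forall_fin_four ?_ ?_ ?_ ?_ <;> intro hcd <;>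
    first | (exfalso; revert hcd; decide) | skip
  all_goals
    refine forall_fin_four ?_ ?_ ?_ ?_ <;> refine forall_fin_four ?_ ?_ ?_ ?_ <;>
    simp only [↓Matrix.cons_val, neutralGamma, neutralGammaRe, neutralGammaIm, affineFn,
      neutralCurvature, mixedCurvature, horCurvature, Pi.zero_apply, Pi.neg_apply, pdRe_neg,
      pdIm_neg, pdRe_zero, pdIm_zero, e1, e2, e3] <;> ring

lemma riemann_neutralMatrix (hT : IsOpen T) (hu : ContDiffOn ℝ ∞ u T)
    (hx : (toCC x).1 ∈ T) (a b c d : Fin 4) :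
    riemann (neutralMatrix u) a b c d x =
      neutralCurvature (lapl u (toCC x).1) (laplTwist u x) c d a b := by
  rcases lt_trichotomy c d with h | rfl | h
  · exact riemann_neutralMatrix_of_lt hT hu hx c d h a b
  -- On the diagonal each side equals its own negative.
  · linarith [riemann_swap (neutralMatrix u) a b c c x,
      neutralCurvature_swap (lapl u (toCC x).1) (laplTwist u x) a b c c]
  · rw [riemann_swap, riemann_neutralMatrix_of_lt hT hu hx d c h, ← neutralCurvature_swap]

lemma ricci_neutralMatrix (hT : IsOpen T) (hu : ContDiffOn ℝ ∞ u T)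
    (hx : (toCC x).1 ∈ T) (b d : Fin 4) :
    ricci (neutralMatrix u) b d x =
      ![![-2, 0, 0, 0], 0, ![0, 0, -2, 0], 0] b d * lapl u (toCC x).1 := by
  simp only [ricci, riemann_neutralMatrix hT hu hx, Fin.sum_univ_four]
  generalize lapl u (toCC x).1 = l
  generalize laplTwist u x = k
  revert b d
  refine forall_fin_four ?_ ?_ ?_ ?_ <;> refine forall_fin_four ?_ ?_ ?_ ?_ <;>
    simp only [↓Matrix.cons_val, neutralCurvature, mixedCurvature, horCurvature, Pi.zero_apply,
      Pi.neg_apply] <;> ring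

/-- The Ricci tensor lives on the index pairs `(0, 0)` and `(2, 2)`, where the inverse metric is
zero. -/
lemma scalarCurv_neutralMatrix (hT : IsOpen T) (hu : ContDiffOn ℝ ∞ u T)
    (hx : (toCC x).1 ∈ T) : scalarCurv (neutralMatrix u) x = 0 := by
  simp [scalarCurv, ricci_neutralMatrix hT hu hx, Fin.sum_univ_four, neutralMatrix_inv,
    neutralShapeInv]

/-- The Ricci term cancels everything outside the `0202` block. There `R_{0202} = e^{2u} (k + 2hl)`,
and the correction is `-4 e^{2u} hl` because `G_{00} = G_{22} = -2 e^{2u} h`. -/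
lemma weylLow_neutralMatrix (hT : IsOpen T) (hu : ContDiffOn ℝ ∞ u T)
    (hx : (toCC x).1 ∈ T) (a b c d : Fin 4) :
    weylLow (neutralMatrix u) a b c d x =
      Real.exp (2 * u (toCC x).1) *
        (laplTwist u x - 2 * twist u x * lapl u (toCC x).1) * (horForm a b * horForm c d) := by
  simp only [weylLow, riemannLow, riemann_neutralMatrix hT hu hx, ricci_neutralMatrix hT hu hx,
    scalarCurv_neutralMatrix hT hu hx, Fin.sum_univ_four, neutralMatrix, Matrix.smul_apply,
    smul_eq_mul]
  generalize lapl u (toCC x).1 = l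
  generalize laplTwist u x = k
  generalize twist u x = h
  generalize Real.exp (2 * u (toCC x).1) = F
  revert c d a b
  refine forall_fin_four ?_ ?_ ?_ ?_ <;> refine forall_fin_four ?_ ?_ ?_ ?_ <;>
    refine forall_fin_four ?_ ?_ ?_ ?_ <;> refine forall_fin_four ?_ ?_ ?_ ?_ <;>
    simp only [↓Matrix.cons_val, neutralCurvature, mixedCurvature, horCurvature, Pi.zero_apply,
      Pi.neg_apply, neutralShape, Matrix.of_apply, horForm] <;> ring

/-- Up to `e^{-2u}`, raising the index sends `dx⁰` to `-∂_3` and `dx²` to `∂_1`, hence `dx⁰ ∧ dx²`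
to `∂_1 ∧ ∂_3`; the entries `2h` of the inverse play no part. -/
lemma weyl_neutralMatrix (hT : IsOpen T) (hu : ContDiffOn ℝ ∞ u T)
    (hx : (toCC x).1 ∈ T) (a b c d : Fin 4) :
    weyl (neutralMatrix u) a b c d x =
      (Real.exp (2 * u (toCC x).1))⁻¹ *
        (laplTwist u x - 2 * twist u x * lapl u (toCC x).1) * (horForm a b * vertForm c d) := by
  have hF := (Real.exp_pos (2 * u (toCC x).1)).ne'
  simp only [weyl, weylLow_neutralMatrix hT hu hx, neutralMatrix_inv, Fin.sum_univ_four,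
    Matrix.smul_apply, smul_eq_mul]
  generalize lapl u (toCC x).1 = l
  generalize laplTwist u x = k
  generalize twist u x = h
  generalize horForm a b = w
  fin_cases c <;> fin_cases d <;> simp [↓Matrix.cons_val, neutralShapeInv, horForm, vertForm] <;> field_simp

end FourDim

/-! ### The Weyl tensor on 2-forms and in complex coordinates -/

/-- The raised `horForm` is a multiple of `vertForm`, so its Hodge star needs only the symbols
beginning with `1, 3` or `3, 1`. The odd permutation `(1, 3, 0, 2)` supplies the sign that makes it
anti-self-dual. -/
lemma leviCivita_one_three (a b : Fin 4) : leviCivita 1 3 a b = -horForm a b := by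
  have h : (Matrix.of fun i k : Fin 4 => if ![1, 3, a, b] i = k then (1 : ℝ) else 0) =
      !![0, 1, 0, 0; 0, 0, 0, 1;
        if a = 0 then 1 else 0, if a = 1 then 1 else 0, if a = 2 then 1 else 0,
          if a = 3 then 1 else 0;
        if b = 0 then 1 else 0, if b = 1 then 1 else 0, if b = 2 then 1 else 0,
          if b = 3 then 1 else 0] := by
    ext i k
    fin_cases i <;> fin_cases k <;> simp <;> congr
  rw [leviCivita, h, Matrix.det_succ_row_zero]
  simp [Fin.sum_univ_succ, Matrix.det_fin_three, Fin.succAbove]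
  revert a b
  refine forall_fin_four ?_ ?_ ?_ ?_ <;> refine forall_fin_four ?_ ?_ ?_ ?_ <;> intro _ <;>
    simp [horForm]

lemma leviCivita_three_one (a b : Fin 4) : leviCivita 3 1 a b = horForm a b := by
  have h : leviCivita 3 1 a b = -leviCivita 1 3 a b := by
    have hs := Matrix.det_permute (Equiv.swap (0 : Fin 4) 1)
      (Matrix.of fun i k : Fin 4 => if ![1, 3, a, b] i = k then (1 : ℝ) else 0)
    rw [Equiv.Perm.sign_swap (by decide)] at hs
    rw [leviCivita, leviCivita]
    convert hs using 2
    · ext i k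
      fin_cases i <;> simp [Equiv.swap_apply_def] <;> congr
    · simp
  rw [h, leviCivita_one_three, neg_neg]

lemma sum_inv_neutralMatrix_horForm (u : ℂ → ℝ) (x : Fin 4 → ℝ) (c d : Fin 4) :
    ∑ e, ∑ f, (neutralMatrix u x)⁻¹ c e * (neutralMatrix u x)⁻¹ d f * horForm e f =
      (Real.exp (2 * u (toCC x).1))⁻¹ ^ 2 * vertForm c d := by
  simp only [neutralMatrix_inv, Fin.sum_univ_four, Matrix.smul_apply, smul_eq_mul]
  generalize twist u x = h
  generalize (Real.exp (2 * u (toCC x).1))⁻¹ = F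
  revert c d
  refine forall_fin_four ?_ ?_ ?_ ?_ <;> refine forall_fin_four ?_ ?_ ?_ ?_ <;>
    simp [neutralShapeInv, horForm, vertForm] <;> ring

/-- The 2-form `dξ ∧ dξ̄` is anti-self-dual. -/
lemma hodgeStar_horForm (u : ℂ → ℝ) (x : Fin 4 → ℝ) :
    hodgeStar (neutralMatrix u x) horForm = -horForm := by
  have hF := Real.exp_pos (2 * u (toCC x).1)
  ext a b
  simp only [hodgeStar, Matrix.of_apply, sum_inv_neutralMatrix_horForm, neutralMatrix_det]
  -- The volume factor `e^{4u}` cancels the `e^{-4u}` from raising two indices.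
  have hs : √|Real.exp (2 * u (toCC x).1) ^ 4| = Real.exp (2 * u (toCC x).1) ^ 2 := by
    rw [abs_of_pos (by positivity), show Real.exp (2 * u (toCC x).1) ^ 4 =
      (Real.exp (2 * u (toCC x).1) ^ 2) ^ 2 by ring, Real.sqrt_sq (by positivity)]
  rw [hs]
  simp [Fin.sum_univ_four, vertForm, leviCivita_one_three, leviCivita_three_one]
  field_simp
  ring

lemma hodgeStar_smul (g w : Matrix (Fin 4) (Fin 4) ℝ) (r : ℝ) :
    hodgeStar g (r • w) = r • hodgeStar g w := by
  ext a b
  simp only [hodgeStar, Matrix.of_apply, Matrix.smul_apply, smul_eq_mul, Finset.mul_sum]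
  refine Finset.sum_congr rfl fun c _ => Finset.sum_congr rfl fun d _ =>
    Finset.sum_congr rfl fun e _ => Finset.sum_congr rfl fun f _ => by ring

/-- Every value of the Weyl operator is a multiple of `horForm`, which the outer self-dual
projection kills. -/
lemma isAntiSelfDualAt_of_weyl {G : CoordMetric 4} {u : ℂ → ℝ} {x : Fin 4 → ℝ} {r : ℝ}
    (hG : G x = neutralMatrix u x)
    (hW : ∀ a b c d, weyl G a b c d x = r * (horForm a b * vertForm c d)) :
    IsAntiSelfDualAt G x := by
  intro w _
  have h : ∀ v, weylOp G x v = ((1 / 2) * r * ∑ c, ∑ d, vertForm c d * v c d) • horForm := by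
    intro v
    ext a b
    simp only [weylOp, Matrix.of_apply, hW, Matrix.smul_apply, smul_eq_mul, Finset.mul_sum,
      Finset.sum_mul]
    refine Finset.sum_congr rfl fun c _ => Finset.sum_congr rfl fun d _ => by ring
  rw [weylPlus, h, selfDualPart, hodgeStar_smul, hG, hodgeStar_horForm]
  simp

/-- `horForm` sees only the `ξ`-directions and `vertForm` only the `η`-directions, so the
contraction factors into two minors. -/
lemma weylComplex_of_weyl {G : CoordMetric 4} {x : Fin 4 → ℝ} {r : ℝ}
    (hW : ∀ a b c d, weyl G a b c d x = r * (horForm a b * vertForm c d)) (A B C D : CIdx) :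
    weylComplex G x A B C D =
      r * (A.vec 0 * B.vec 2 - A.vec 2 * B.vec 0) *
        (C.covec 1 * D.covec 3 - C.covec 3 * D.covec 1) := by
  simp only [weylComplex, hW, Fin.sum_univ_four]
  simp [horForm, vertForm]
  ring

lemma vec_wedge_eq_zero {A B : CIdx} (h : ({A, B} : Set CIdx) ≠ {.xi, .xiBar}) :
    A.vec 0 * B.vec 2 - A.vec 2 * B.vec 0 = 0 := by
  cases A <;> cases B <;>
    first
      | exact absurd rfl h
      | exact absurd (Set.pair_comm _ _) h
      | (simp [CIdx.vec] <;> ring)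

lemma covec_wedge_eq_zero {C D : CIdx} (h : ({C, D} : Set CIdx) ≠ {.eta, .etaBar}) :
    C.covec 1 * D.covec 3 - C.covec 3 * D.covec 1 = 0 := by
  cases C <;> cases D <;>
    first
      | exact absurd rfl h
      | exact absurd (Set.pair_comm _ _) h
      | simp [CIdx.covec]

lemma weylComplex_eq_zero_of_weyl {G : CoordMetric 4} {x : Fin 4 → ℝ} {r : ℝ}
    (hW : ∀ a b c d, weyl G a b c d x = r * (horForm a b * vertForm c d)) {A B C D : CIdx}
    (h : ¬ (({A, B} : Set CIdx) = {.xi, .xiBar} ∧ ({C, D} : Set CIdx) = {.eta, .etaBar})) :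
    weylComplex G x A B C D = 0 := by
  rw [weylComplex_of_weyl hW]
  by_cases hA : ({A, B} : Set CIdx) = {.xi, .xiBar}
  · rw [covec_wedge_eq_zero fun hC => h ⟨hA, hC⟩, mul_zero]
  · rw [vec_wedge_eq_zero hA, mul_zero, zero_mul]

lemma weylComplex_xi_eta_of_weyl {G : CoordMetric 4} {x : Fin 4 → ℝ} {r : ℝ}
    (hW : ∀ a b c d, weyl G a b c d x = r * (horForm a b * vertForm c d)) :
    weylComplex G x .xi .xiBar .eta .etaBar = r := by
  rw [weylComplex_of_weyl hW]
  -- The two minors are `i/2` and `-2i`.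
  have h : (1 / 2 * (Complex.I / 2) - -(Complex.I / 2) * (1 / 2)) *
      (1 * -Complex.I - Complex.I * 1) = 1 := by
    linear_combination (-1 : ℂ) * Complex.I_sq
  simpa [CIdx.vec, CIdx.covec, mul_assoc] using congrArg ((r : ℂ) * ·) h

section Curvature

variable {T : Set ℂ} {u : ℂ → ℝ} {κ : ℂ → ℝ} {ξ : ℂ}

lemma differentiableAt_lapl (hT : IsOpen T) (hu : ContDiffOn ℝ ∞ u T) (hξ : ξ ∈ T) :
    DifferentiableAt ℝ (lapl u) ξ :=
  (differentiableAt_of_contDiffOn hT (contDiffOn_pdRe hT (contDiffOn_pdRe hT hu)) hξ).add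
    (differentiableAt_of_contDiffOn hT (contDiffOn_pdIm hT (contDiffOn_pdIm hT hu)) hξ)

lemma fderiv_gauss (hT : IsOpen T) (hu : ContDiffOn ℝ ∞ u T) (hξ : ξ ∈ T)
    (hκ : κ =ᶠ[nhds ξ] fun z => -(Real.exp (2 * u z))⁻¹ * lapl u z) (v : ℂ) :
    fderiv ℝ κ ξ v = (Real.exp (2 * u ξ))⁻¹ *
      (2 * lapl u ξ * fderiv ℝ u ξ v - fderiv ℝ (lapl u) ξ v) := by
  have hd := (differentiableAt_of_contDiffOn hT hu hξ).hasFDerivAt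
  have hl := (differentiableAt_lapl hT hu hξ).hasFDerivAt
  have hκ' : κ =ᶠ[nhds ξ] fun z => -(Real.exp (-2 * u z) * lapl u z) := by
    filter_upwards [hκ] with z hz
    rw [hz, ← Real.exp_neg]
    ring_nf
  have h := ((hd.const_mul (-2)).exp.mul hl).neg
  rw [hκ'.fderiv_eq]
  erw [h.fderiv]
  rw [← Real.exp_neg, ← neg_mul]
  simp
  ring

/-- From `dκ = e^{-2u} (2 Δu du - d(Δu))`, both sides equal `-2 Im (η ∂_ξ κ)`; recall `i (z - z̄) =
-2 Im z`. -/
lemma weyl_coefficient_eq (hT : IsOpen T) (hu : ContDiffOn ℝ ∞ u T) (hξ : ξ ∈ T)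
    (hκ : κ =ᶠ[nhds ξ] fun z => -(Real.exp (2 * u z))⁻¹ * lapl u z) (η : ℂ) :
    (((Real.exp (2 * u ξ))⁻¹ * (laplTwist u (ofCC ξ η) - 2 * twist u (ofCC ξ η) * lapl u ξ) : ℝ) :
      ℂ) = Complex.I * (η * dXi κ ξ - conj η * dXiBar κ ξ) := by
  rw [dXi, dXiBar, fderiv_gauss hT hu hξ hκ, fderiv_gauss hT hu hξ hκ]
  generalize (Real.exp (2 * u ξ))⁻¹ = E
  apply Complex.ext
  · simp [laplTwist, twist, affineFn, ofCC, toCC, pdRe, pdIm]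
    ring
  · simp [laplTwist, twist, affineFn, ofCC, toCC, pdRe, pdIm]

end Curvature

/-! ### Change of conformal coordinate -/

lemma fderiv_eq_re_dXi {f : ℂ → ℝ} {z : ℂ} (v : ℂ) :
    fderiv ℝ f z v = 2 * (dXi f z * v).re := by
  have hv : v = v.re • (1 : ℂ) + v.im • Complex.I := by
    apply Complex.ext <;> simp
  conv_lhs => rw [hv, map_add, map_smul, map_smul]
  simp [dXi]
  ring

/-- With `df = 2 Re (∂_ξ f dξ)`, this turns an identity of real differentials into one for `∂_ξ`. -/
lemma eq_of_re_mul_eq {a b : ℂ} (h : ∀ v : ℂ, (a * v).re = (b * v).re) : a = b := by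
  have h1 := h 1
  have h2 := h Complex.I
  apply Complex.ext
  · simpa using h1
  · simpa using h2

/-- The transformation of `∂_ξ u` under a holomorphic change of coordinate `f` with
`e^{2u'(f)} |f'|² = e^{2u}`. -/
lemma dXi_transform {f : ℂ → ℂ} {u u' : ℂ → ℝ} {ξ : ℂ} {c' : ℂ}
    (hf : DifferentiableAt ℂ f ξ) (hf' : HasDerivAt (deriv f) c' ξ)
    (hu : DifferentiableAt ℝ u ξ) (hu' : DifferentiableAt ℝ u' (f ξ))
    (h : ∀ᶠ z in nhds ξ,
      Real.exp (2 * u' (f z)) * Complex.normSq (deriv f z) = Real.exp (2 * u z)) :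
    Complex.normSq (deriv f ξ) * dXi u ξ =
      Complex.normSq (deriv f ξ) * dXi u' (f ξ) * deriv f ξ + 1 / 2 * (conj (deriv f ξ) * c') := by
  have hfR : HasFDerivAt f ((ContinuousLinearMap.toSpanSingleton ℂ (deriv f ξ)).restrictScalars ℝ)
      ξ := hf.hasDerivAt.hasFDerivAt.restrictScalars ℝ
  have hcR : HasFDerivAt (deriv f) ((ContinuousLinearMap.toSpanSingleton ℂ c').restrictScalars ℝ)
      ξ := hf'.hasFDerivAt.restrictScalars ℝ
  have hre : HasFDerivAt (fun z => (deriv f z).re)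
      (Complex.reCLM.comp ((ContinuousLinearMap.toSpanSingleton ℂ c').restrictScalars ℝ)) ξ :=
    Complex.reCLM.hasFDerivAt.comp ξ hcR
  have him : HasFDerivAt (fun z => (deriv f z).im)
      (Complex.imCLM.comp ((ContinuousLinearMap.toSpanSingleton ℂ c').restrictScalars ℝ)) ξ :=
    Complex.imCLM.hasFDerivAt.comp ξ hcR
  -- Both sides of `h` are differentiated over `ℝ`, with `|f'|²` written as `(Re f')² + (Im f')²`,
  -- and the two derivatives are compared.
  have hU' := (((hu'.hasFDerivAt.comp ξ hfR).const_mul 2).exp).mul ((hre.mul hre).add (him.mul him))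
  have hU := (hu.hasFDerivAt.const_mul 2).exp
  have heq := hU'.unique (hU.congr_of_eventuallyEq (h.mono fun z hz => by
    simpa [Complex.normSq_apply] using hz))
  have h0 := h.self_of_nhds
  have hE := Real.exp_pos (2 * u' (f ξ))
  apply eq_of_re_mul_eq
  intro v
  have hv := DFunLike.congr_fun heq v
  rw [← h0] at hv
  simp only [add_apply, smul_apply,
    ContinuousLinearMap.comp_apply, ContinuousLinearMap.coe_restrictScalars',
    ContinuousLinearMap.toSpanSingleton_apply, smul_eq_mul, Complex.reCLM_apply,
    Complex.imCLM_apply, fderiv_eq_re_dXi, Function.comp_apply] at hv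
  simp [Complex.normSq_apply] at hv ⊢
  apply mul_left_cancel₀ hE.ne'
  linear_combination (-1 / 4) * hv

/-- Here `c = f'` and `c' = f''`, and the vectors are transformed by the differential of `(ξ, η) ↦
(f ξ, f' η)`. The two `f''` contributions add up to `½ (s + s̄)(t + t̄)` with `s = η f̄' f''` and `t
= X₁ Ȳ₁`, which is real. -/
lemma neutralForm_transform {u u' : ℂ → ℝ} {ξ ζ c c' η : ℂ}
    (hE : Real.exp (2 * u' ζ) * Complex.normSq c = Real.exp (2 * u ξ))
    (hU : Complex.normSq c * dXi u ξ = Complex.normSq c * dXi u' ζ * c + 1 / 2 * (conj c * c'))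
    (X Y : ℂ × ℂ) :
    neutralForm u' (ζ, c * η) (c * X.1, c * X.2 + η * (c' * X.1))
        (c * Y.1, c * Y.2 + η * (c' * Y.1)) =
      neutralForm u (ξ, η) X Y := by
  obtain ⟨X1, X2⟩ := X
  obtain ⟨Y1, Y2⟩ := Y
  simp only [neutralForm, ← hE]
  have key : (1 / 2 * (conj (c * X2 + η * (c' * X1)) * (c * Y1) +
        conj (c * Y2 + η * (c' * Y1)) * (c * X1)) -
      2 * (c * η) * dXi u' ζ * (1 / 2 * (c * X1 * conj (c * Y1) + c * Y1 * conj (c * X1)))) =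
      Complex.normSq c * (1 / 2 * (conj X2 * Y1 + conj Y2 * X1) -
        2 * η * dXi u ξ * (1 / 2 * (X1 * conj Y1 + Y1 * conj X1))) +
      1 / 2 * ((η * conj c * c' + conj (η * conj c * c')) * (X1 * conj Y1 + conj (X1 * conj Y1))) := by
    simp only [Complex.normSq_eq_conj_mul_self, map_mul, map_add, Complex.conj_conj] at hU ⊢
    linear_combination (η * (X1 * conj Y1 + Y1 * conj X1)) * hU
  rw [key, Complex.add_im, Complex.im_ofReal_mul, Complex.add_conj, Complex.add_conj]
  have h0 : (1 / 2 * (((2 * (η * conj c * c').re : ℝ) : ℂ) * ((2 * (X1 * conj Y1).re : ℝ) : ℂ))).im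
      = 0 := by
    rw [← Complex.ofReal_mul, ← Complex.ofReal_ofNat, ← Complex.ofReal_one, ← Complex.ofReal_div,
      ← Complex.ofReal_mul, Complex.ofReal_im]
  rw [h0]
  ring

/-! ### The coordinates on the surface and on its tangent bundle -/

section Surface

variable {N : Type*} [TopologicalSpace N] [ChartedSpace ℂ N] {φ φ' : OpenPartialHomeomorph N ℂ}

lemma mdifferentiable_of_mem_maximalAtlas (hφ : φ ∈ IsManifold.maximalAtlas 𝓘(ℝ, ℂ) ∞ N) :
    φ.MDifferentiable 𝓘(ℝ, ℂ) 𝓘(ℝ, ℂ) :=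
  ⟨(contMDiffOn_of_mem_maximalAtlas hφ).mdifferentiableOn (by simp),
    (contMDiffOn_symm_of_mem_maximalAtlas hφ).mdifferentiableOn (by simp)⟩

/-- The inverse `w ↦ w ∂_ξ + w̄ ∂_{ξ̄}` of `dξ` at the point with coordinate `ξ`. -/
def coordVector (φ : OpenPartialHomeomorph N ℂ) (ξ : ℂ) :
    ℂ →L[ℝ] TangentSpace 𝓘(ℝ, ℂ) (φ.symm ξ) :=
  mfderiv 𝓘(ℝ, ℂ) 𝓘(ℝ, ℂ) φ.symm ξ

lemma dCoord_coordVector (hφ : φ ∈ IsManifold.maximalAtlas 𝓘(ℝ, ℂ) ∞ N) {ξ : ℂ}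
    (hξ : ξ ∈ φ.target) (w : ℂ) : dCoord φ (φ.symm ξ) (coordVector φ ξ w) = w :=
  DFunLike.congr_fun ((mdifferentiable_of_mem_maximalAtlas hφ).comp_symm_deriv hξ) w

lemma dCoord_injective (hφ : φ ∈ IsManifold.maximalAtlas 𝓘(ℝ, ℂ) ∞ N) {p : N}
    (hp : p ∈ φ.source) : Function.Injective (dCoord φ p) :=
  (mdifferentiable_of_mem_maximalAtlas hφ).mfderiv_injective hp

lemma fderiv_transition (hφ : φ ∈ IsManifold.maximalAtlas 𝓘(ℝ, ℂ) ∞ N)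
    (hφ' : φ' ∈ IsManifold.maximalAtlas 𝓘(ℝ, ℂ) ∞ N) {ξ : ℂ} (hξ : ξ ∈ φ.target)
    (hp : φ.symm ξ ∈ φ'.source) :
    HasFDerivAt (φ' ∘ φ.symm) ((dCoord φ' (φ.symm ξ)).comp (coordVector φ ξ)) ξ := by
  have h1 := ((mdifferentiable_of_mem_maximalAtlas hφ).mdifferentiableAt_symm hξ).hasMFDerivAt
  have h2 := ((mdifferentiable_of_mem_maximalAtlas hφ').mdifferentiableAt hp).hasMFDerivAt
  exact (h2.comp ξ h1).hasFDerivAt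

variable [IsManifold 𝓘(ℝ, ℂ) ∞ N]

/-- The fibre coordinate is the second component of the tangent map of `φ`. Differentiability must
be proved for the chain rule, as `mfderiv` defaults to zero. -/
lemma mdifferentiableAt_bundleCoord (hφ : φ ∈ IsManifold.maximalAtlas 𝓘(ℝ, ℂ) ∞ N)
    {v : TangentBundle 𝓘(ℝ, ℂ) N} (hv : v.proj ∈ φ.source) :
    MDifferentiableAt 𝓘(ℝ, ℂ).tangent 𝓘(ℝ, ℂ × ℂ) (bundleCoord φ) v := by
  have hs : IsOpen (Bundle.TotalSpace.proj ⁻¹' φ.source : Set (TangentBundle 𝓘(ℝ, ℂ) N)) :=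
    φ.open_source.preimage (FiberBundle.continuous_proj ℂ _)
  have h1 : MDifferentiableAt 𝓘(ℝ, ℂ).tangent 𝓘(ℝ, ℂ)
      (fun w : TangentBundle 𝓘(ℝ, ℂ) N => φ w.proj) v :=
    ((mdifferentiable_of_mem_maximalAtlas hφ).mdifferentiableAt hv).comp v
      (mdifferentiableAt_proj _)
  have h2 : ContMDiffOn 𝓘(ℝ, ℂ).tangent 𝓘(ℝ, ℂ).tangent 1
      (tangentMapWithin 𝓘(ℝ, ℂ) 𝓘(ℝ, ℂ) φ φ.source) (Bundle.TotalSpace.proj ⁻¹' φ.source) :=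
    (contMDiffOn_of_mem_maximalAtlas hφ).contMDiffOn_tangentMapWithin (by norm_cast)
      φ.open_source.uniqueMDiffOn
  have h3 : ContMDiffAt 𝓘(ℝ, ℂ).tangent 𝓘(ℝ, ℂ) 1
      (fun w => (tangentMapWithin 𝓘(ℝ, ℂ) 𝓘(ℝ, ℂ) φ φ.source w).2) v :=
    (contMDiff_snd_tangentBundle_modelSpace ℂ 𝓘(ℝ, ℂ)).contMDiffAt.comp v
      (h2.contMDiffAt (hs.mem_nhds hv))
  have h4 : MDifferentiableAt 𝓘(ℝ, ℂ).tangent 𝓘(ℝ, ℂ)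
      (fun w : TangentBundle 𝓘(ℝ, ℂ) N => (dCoord φ w.proj w.2 : ℂ)) v := by
    refine (h3.mdifferentiableAt (by simp)).congr_of_eventuallyEq ?_
    filter_upwards [hs.mem_nhds hv] with w hw
    rw [tangentMapWithin_eq_tangentMap (φ.open_source.uniqueMDiffOn _ hw)
      ((mdifferentiable_of_mem_maximalAtlas hφ).mdifferentiableAt hw)]
    rfl
  exact h1.prodMk_space h4

lemma mdifferentiableAt_bundlePoint (hφ : φ ∈ IsManifold.maximalAtlas 𝓘(ℝ, ℂ) ∞ N)
    {x : Fin 4 → ℝ} (hx : (toCC x).1 ∈ φ.target) :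
    MDifferentiableAt 𝓘(ℝ, Fin 4 → ℝ) 𝓘(ℝ, ℂ).tangent (bundlePoint φ) x := by
  have hs : IsOpen (Bundle.TotalSpace.proj ⁻¹' φ.target : Set (TangentBundle 𝓘(ℝ, ℂ) ℂ)) :=
    φ.open_target.preimage (FiberBundle.continuous_proj ℂ _)
  have h2 : ContMDiffOn 𝓘(ℝ, ℂ).tangent 𝓘(ℝ, ℂ).tangent 1
      (tangentMapWithin 𝓘(ℝ, ℂ) 𝓘(ℝ, ℂ) φ.symm φ.target) (Bundle.TotalSpace.proj ⁻¹' φ.target) :=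
    (contMDiffOn_symm_of_mem_maximalAtlas hφ).contMDiffOn_tangentMapWithin (by norm_cast)
      φ.open_target.uniqueMDiffOn
  have h1 : ContMDiffAt 𝓘(ℝ, Fin 4 → ℝ) 𝓘(ℝ, ℂ).tangent 1
      (fun y => (⟨projXi y, projEta y⟩ : TangentBundle 𝓘(ℝ, ℂ) ℂ)) x := by
    rw [Bundle.contMDiffAt_totalSpace]
    refine ⟨projXi.contDiff.contMDiff.contMDiffAt, ?_⟩
    refine (projEta.contDiff.contMDiff.contMDiffAt).congr_of_eventuallyEq ?_
    filter_upwards with y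
    simp
  have hx' : (⟨projXi x, projEta x⟩ : TangentBundle 𝓘(ℝ, ℂ) ℂ) ∈
      (Bundle.TotalSpace.proj ⁻¹' φ.target : Set (TangentBundle 𝓘(ℝ, ℂ) ℂ)) := by
    simpa [projXi_apply] using hx
  have h3 := (h2.contMDiffAt (hs.mem_nhds hx')).comp x h1
  refine (h3.mdifferentiableAt (by simp)).congr_of_eventuallyEq ?_
  filter_upwards [continuous_toCC_fst.continuousAt.eventually (φ.open_target.mem_nhds hx)] with y hy
  rw [Function.comp_apply, tangentMapWithin_eq_tangentMap]
  -- Base and fibre are made variables so that both equalities can be substituted in the dependent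
  -- pair.
  · have h : ∀ a b : ℂ, a = (toCC y).1 → b = (toCC y).2 →
        bundlePoint φ y = tangentMap 𝓘(ℝ, ℂ) 𝓘(ℝ, ℂ) φ.symm ⟨a, b⟩ := by
      rintro _ _ rfl rfl
      rfl
    exact h _ _ (projXi_apply y) (projEta_apply y)
  · simpa only [projXi_apply] using φ.open_target.uniqueMDiffOn _ hy
  · simpa only [projXi_apply] using
      (mdifferentiable_of_mem_maximalAtlas hφ).mdifferentiableAt_symm hy

end Surface

/-! ### The components of the two metrics -/

section Components

variable {N : Type*} [TopologicalSpace N] [ChartedSpace ℂ N] [IsManifold 𝓘(ℝ, ℂ) ∞ N]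
variable {g : SurfaceMetric N} {o : SurfaceOrientation g} {φ φ' : OpenPartialHomeomorph N ℂ}
variable {u u' : ℂ → ℝ} {ξ : ℂ}

lemma inner_coordVector (hφ : IsConformalCoord g o φ u) (hξ : ξ ∈ φ.target) (w z : ℂ) :
    g.inner (φ.symm ξ) (coordVector φ ξ w) (coordVector φ ξ z) =
      Real.exp (2 * u ξ) * (w * conj z).re := by
  rw [hφ.metric _ (φ.map_target hξ), φ.right_inv hξ,
    dCoord_coordVector hφ.mem_maximalAtlas hξ, dCoord_coordVector hφ.mem_maximalAtlas hξ]

lemma surfaceComponents_eq (hφ : IsConformalCoord g o φ u) {x : Fin 2 → ℝ}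
    (hx : toC x ∈ φ.target) : surfaceComponents g φ x = conformalMatrix u x := by
  ext a b
  refine (inner_coordVector hφ hx (toC (Pi.single a 1)) (toC (Pi.single b 1))).trans ?_
  fin_cases a <;> fin_cases b <;> simp [conformalMatrix, toC]

lemma gaussCurvature_eq (hφ : IsConformalCoord g o φ u) (hξ : ξ ∈ φ.target) :
    gaussCurvature g φ ξ = -(Real.exp (2 * u ξ))⁻¹ * lapl u ξ := by
  have hC : toC (ofC ξ) = ξ := rfl
  have hmem : ∀ᶠ y in nhds (ofC ξ), toC y ∈ φ.target :=
    continuous_toC.continuousAt.eventually (φ.open_target.mem_nhds hξ)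
  have h : surfaceComponents g φ =ᶠ[nhds (ofC ξ)] conformalMatrix u :=
    hmem.mono fun y hy => surfaceComponents_eq hφ hy
  rw [gaussCurvature, gauss_congr h,
    gauss_conformalMatrix (x := ofC ξ) φ.open_target hφ.contDiffOn hξ, hC]

lemma coordVector_mul_I (hφ : IsConformalCoord g o φ u) (hξ : ξ ∈ φ.target) (w : ℂ) :
    coordVector φ ξ (Complex.I * w) = o.rot _ (coordVector φ ξ w) := by
  apply dCoord_injective hφ.mem_maximalAtlas (φ.map_target hξ)
  rw [hφ.oriented _ (φ.map_target hξ), dCoord_coordVector hφ.mem_maximalAtlas hξ,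
    dCoord_coordVector hφ.mem_maximalAtlas hξ]

/-- Both coordinates intertwine the rotation of the tangent plane with multiplication by `i`, which
gives the Cauchy–Riemann equation. -/
lemma differentiableAt_transition (hφ : IsConformalCoord g o φ u)
    (hφ' : IsConformalCoord g o φ' u') (hξ : ξ ∈ φ.target) (hp : φ.symm ξ ∈ φ'.source) :
    DifferentiableAt ℂ (φ' ∘ φ.symm) ξ := by
  have h := fderiv_transition hφ.mem_maximalAtlas hφ'.mem_maximalAtlas hξ hp
  rw [differentiableAt_complex_iff_differentiableAt_real]
  refine ⟨h.differentiableAt, ?_⟩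
  rw [h.fderiv, ContinuousLinearMap.comp_apply, ContinuousLinearMap.comp_apply]
  conv_lhs => rw [← mul_one Complex.I]
  rw [coordVector_mul_I hφ hξ, hφ'.oriented _ hp, smul_eq_mul]

lemma dCoord_coordVector_eq_deriv (hφ : IsConformalCoord g o φ u)
    (hφ' : IsConformalCoord g o φ' u') (hξ : ξ ∈ φ.target) (hp : φ.symm ξ ∈ φ'.source) (w : ℂ) :
    dCoord φ' (φ.symm ξ) (coordVector φ ξ w) = deriv (φ' ∘ φ.symm) ξ * w := by
  have h := fderiv_transition hφ.mem_maximalAtlas hφ'.mem_maximalAtlas hξ hp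
  have h' := (differentiableAt_transition hφ hφ' hξ hp).hasDerivAt.hasFDerivAt.restrictScalars ℝ
  have := DFunLike.congr_fun (h.unique h') w
  rw [ContinuousLinearMap.comp_apply] at this
  rw [this]
  simp [mul_comm]

/-- Both sides are the squared length of `coordVector φ ξ 1`. -/
lemma exp_transition (hφ : IsConformalCoord g o φ u)
    (hφ' : IsConformalCoord g o φ' u') (hξ : ξ ∈ φ.target) (hp : φ.symm ξ ∈ φ'.source) :
    Real.exp (2 * u' ((φ' ∘ φ.symm) ξ)) * Complex.normSq (deriv (φ' ∘ φ.symm) ξ) =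
      Real.exp (2 * u ξ) := by
  have h1 := inner_coordVector hφ hξ 1 1
  rw [hφ'.metric _ hp, dCoord_coordVector_eq_deriv hφ hφ' hξ hp, mul_one, Complex.mul_conj,
    Complex.ofReal_re] at h1
  simpa using h1

lemma hasFDerivAt_bundle_transition {f : ℂ → ℂ} {c' : ℂ} {x : Fin 4 → ℝ}
    (hf : DifferentiableAt ℂ f (toCC x).1) (hf' : HasDerivAt (deriv f) c' (toCC x).1) :
    HasFDerivAt (fun y => (f (toCC y).1, deriv f (toCC y).1 * (toCC y).2))
      ((deriv f (toCC x).1 • projXi).prod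
        (deriv f (toCC x).1 • projEta + (toCC x).2 • (c' • projXi))) x := by
  have h1 : HasFDerivAt (fun y : Fin 4 → ℝ => (toCC y).1) projXi x := by
    simpa only [← projXi_apply] using projXi.hasFDerivAt
  have h2 : HasFDerivAt (fun y : Fin 4 → ℝ => (toCC y).2) projEta x := by
    simpa only [← projEta_apply] using projEta.hasFDerivAt
  have h3 : HasFDerivAt (fun y => deriv f (toCC y).1) (c' • projXi) x :=
    (hf'.comp_hasFDerivAt x h1 : HasFDerivAt (deriv f ∘ fun y => (toCC y).1) _ x)
  exact (hf.hasDerivAt.comp_hasFDerivAt x h1).prodMk (h3.mul h2)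

/-- This is the coordinate independence of `𝔾`: the coordinate chosen in its definition may be
replaced by `φ`. -/
lemma neutralComponents_apply (hφ : IsConformalCoord g o φ u) {x : Fin 4 → ℝ}
    (hx : (toCC x).1 ∈ φ.target) (a b : Fin 4) :
    neutralComponents g o φ x a b =
      neutralForm u (toCC x) (projXi (Pi.single a 1), projEta (Pi.single a 1))
        (projXi (Pi.single b 1), projEta (Pi.single b 1)) := by
  have hsrc : (bundlePoint φ x).proj ∈ φ.source := φ.map_target hx
  have hex : ∃ c : OpenPartialHomeomorph N ℂ × (ℂ → ℝ),
      IsConformalCoord g o c.1 c.2 ∧ (bundlePoint φ x).proj ∈ c.1.source := ⟨(φ, u), hφ, hsrc⟩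
  simp only [neutralComponents, Matrix.of_apply, neutralMetric, dif_pos hex]
  obtain ⟨hφ', hp⟩ := hex.choose_spec
  generalize hex.choose.1 = φ' at *
  generalize hex.choose.2 = u' at *
  set f : ℂ → ℂ := φ' ∘ φ.symm with hf
  have hT : IsOpen (φ.symm.trans φ').source := (φ.symm.trans φ').open_source
  have hTmem : ∀ {z}, z ∈ (φ.symm.trans φ').source ↔ z ∈ φ.target ∧ φ.symm z ∈ φ'.source := by
    intro z; simp
  have hxT : (toCC x).1 ∈ (φ.symm.trans φ').source := hTmem.2 ⟨hx, hp⟩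
  have hfd : DifferentiableOn ℂ f (φ.symm.trans φ').source := fun z hz =>
    (differentiableAt_transition hφ hφ' (hTmem.1 hz).1 (hTmem.1 hz).2).differentiableWithinAt
  have hfx : DifferentiableAt ℂ f (toCC x).1 := hfd.differentiableAt (hT.mem_nhds hxT)
  -- Holomorphy on the open overlap supplies `f''`.
  have hf' : HasDerivAt (deriv f) (deriv (deriv f) (toCC x).1) (toCC x).1 :=
    ((hfd.deriv hT).differentiableAt (hT.mem_nhds hxT)).hasDerivAt
  have hcoord : ∀ y : Fin 4 → ℝ, (toCC y).1 ∈ (φ.symm.trans φ').source →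
      bundleCoord φ' (bundlePoint φ y) = (f (toCC y).1, deriv f (toCC y).1 * (toCC y).2) :=
    fun y hy => Prod.ext rfl
      (dCoord_coordVector_eq_deriv hφ hφ' (hTmem.1 hy).1 (hTmem.1 hy).2 (toCC y).2)
  have hcomp := (hasFDerivAt_bundle_transition hfx hf').congr_of_eventuallyEq
    ((continuous_toCC_fst.continuousAt.eventually (hT.mem_nhds hxT)).mono hcoord)
  let L : (Fin 4 → ℝ) →L[ℝ] ℂ × ℂ :=
    (mfderiv 𝓘(ℝ, ℂ).tangent 𝓘(ℝ, ℂ × ℂ) (bundleCoord φ') (bundlePoint φ x)).comp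
      (mfderiv 𝓘(ℝ, Fin 4 → ℝ) 𝓘(ℝ, ℂ).tangent (bundlePoint φ) x)
  have hL : HasFDerivAt (fun y => bundleCoord φ' (bundlePoint φ y)) L x :=
    ((mdifferentiableAt_bundleCoord hφ'.mem_maximalAtlas hp).hasMFDerivAt.comp x
      (mdifferentiableAt_bundlePoint hφ.mem_maximalAtlas hx).hasMFDerivAt).hasFDerivAt
  -- The differential of the bundle transition is computed by the chain rule and from its explicit
  -- formula.
  have hchain := hL.unique hcomp
  have hD : ∀ w : Fin 4 → ℝ, mfderiv 𝓘(ℝ, ℂ).tangent 𝓘(ℝ, ℂ × ℂ) (bundleCoord φ') (bundlePoint φ x)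
      (mfderiv 𝓘(ℝ, Fin 4 → ℝ) 𝓘(ℝ, ℂ).tangent (bundlePoint φ) x w) =
      (deriv f (toCC x).1 * projXi w, deriv f (toCC x).1 * projEta w +
        (toCC x).2 * (deriv (deriv f) (toCC x).1 * projXi w)) :=
    fun w => DFunLike.congr_fun hchain w
  have hev : ∀ᶠ z in nhds (toCC x).1,
      Real.exp (2 * u' (f z)) * Complex.normSq (deriv f z) = Real.exp (2 * u z) := by
    filter_upwards [hT.mem_nhds hxT] with z hz
    exact exp_transition hφ hφ' (hTmem.1 hz).1 (hTmem.1 hz).2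
  have hu := differentiableAt_of_contDiffOn φ.open_target hφ.contDiffOn hx
  have hu' : DifferentiableAt ℝ u' (f (toCC x).1) :=
    differentiableAt_of_contDiffOn φ'.open_target hφ'.contDiffOn (φ'.map_source hp)
  refine Eq.trans ?_ (neutralForm_transform hev.self_of_nhds (dXi_transform hfx hf' hu hu' hev) _ _)
  rw [hcoord x hxT]
  exact congrArg₂ _ (hD _) (hD _)

lemma neutralForm_eq_neutralMatrix (u : ℂ → ℝ) (x : Fin 4 → ℝ) (a b : Fin 4) :
    neutralForm u (toCC x) (projXi (Pi.single a 1), projEta (Pi.single a 1))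
        (projXi (Pi.single b 1), projEta (Pi.single b 1)) = neutralMatrix u x a b := by
  have h1 : ∀ c : Fin 4, projXi (Pi.single c 1) = ![1, 0, Complex.I, 0] c := by
    intro c
    rw [projXi_apply]
    fin_cases c <;> apply Complex.ext <;> simp [toCC]
  have h2 : ∀ c : Fin 4, projEta (Pi.single c 1) = ![0, 1, 0, Complex.I] c := by
    intro c
    rw [projEta_apply]
    fin_cases c <;> apply Complex.ext <;> simp [toCC]
  have hd : dXi u (toCC x).1 =
      ⟨1 / 2 * pdRe u (toCC x).1, -(1 / 2 * pdIm u (toCC x).1)⟩ := by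
    apply Complex.ext <;> simp [dXi, pdRe, pdIm]
  have he : (toCC x).2 = ⟨x 1, x 3⟩ := rfl
  simp only [h1, h2, neutralForm, neutralMatrix, Matrix.smul_apply, smul_eq_mul, hd, he, twist,
    affineFn]
  generalize (toCC x).1 = z
  generalize Real.exp (2 * u z) = E
  revert a b
  refine forall_fin_four ?_ ?_ ?_ ?_ <;> refine forall_fin_four ?_ ?_ ?_ ?_ <;>
    simp [neutralShape] <;> ring

lemma neutralComponents_eq (hφ : IsConformalCoord g o φ u) {x : Fin 4 → ℝ}
    (hx : (toCC x).1 ∈ φ.target) : neutralComponents g o φ x = neutralMatrix u x := by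
  ext a b
  rw [neutralComponents_apply hφ hx, neutralForm_eq_neutralMatrix]

end Components

end NeutralTN

end

open NeutralTN in
theorem proposition6 {N : Type*} [TopologicalSpace N] [ChartedSpace ℂ N]
    [IsManifold 𝓘(ℝ, ℂ) ∞ N] (g : SurfaceMetric N) (o : SurfaceOrientation g)
    (φ : OpenPartialHomeomorph N ℂ) (u : ℂ → ℝ) (hφ : IsConformalCoord g o φ u)
    (ξ η : ℂ) (hξ : ξ ∈ φ.target) :
    IsAntiSelfDualAt (neutralComponents g o φ) (ofCC ξ η) ∧
    weylComplex (neutralComponents g o φ) (ofCC ξ η) .xi .xiBar .eta .etaBar =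
      Complex.I * (η * dXi (gaussCurvature g φ) ξ - conj η * dXiBar (gaussCurvature g φ) ξ) ∧
    ∀ A B C D : CIdx,
      ¬ (({A, B} : Set CIdx) = {.xi, .xiBar} ∧ ({C, D} : Set CIdx) = {.eta, .etaBar}) →
      weylComplex (neutralComponents g o φ) (ofCC ξ η) A B C D = 0 := by
  have hmem : ∀ᶠ y in nhds (ofCC ξ η), (toCC y).1 ∈ φ.target :=
    continuous_toCC_fst.continuousAt.eventually (φ.open_target.mem_nhds hξ)
  have hG : neutralComponents g o φ =ᶠ[nhds (ofCC ξ η)] neutralMatrix u :=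
    hmem.mono fun y hy => neutralComponents_eq hφ hy
  have hW : ∀ a b c d, weyl (neutralComponents g o φ) a b c d (ofCC ξ η) =
      (Real.exp (2 * u ξ))⁻¹ * (laplTwist u (ofCC ξ η) - 2 * twist u (ofCC ξ η) * lapl u ξ) *
        (horForm a b * vertForm c d) := fun a b c d => by
    rw [weyl_congr hG]
    exact weyl_neutralMatrix (x := ofCC ξ η) φ.open_target hφ.contDiffOn hξ a b c d
  -- A neighbourhood is needed because `κ` gets differentiated.
  have hκ : gaussCurvature g φ =ᶠ[nhds ξ] fun z => -(Real.exp (2 * u z))⁻¹ * lapl u z :=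
    Filter.eventually_of_mem (φ.open_target.mem_nhds hξ) fun z hz => gaussCurvature_eq hφ hz
  refine ⟨isAntiSelfDualAt_of_weyl hG.self_of_nhds hW, ?_, fun A B C D h =>
    weylComplex_eq_zero_of_weyl hW h⟩
  rw [weylComplex_xi_eta_of_weyl hW,
    weyl_coefficient_eq φ.open_target hφ.contDiffOn hξ hκ]
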